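/- **Theorem (Helicity Invariance Theorem).** Regard $S^3$ as the unit quaternions with the round metric and volume form $\mu$. Let $\mathrm{pr}:S^3\setminus\{1\}\to\mathbb R^3$ be stereographic projection from $1$, let $\mathrm{Conf}_3(S^3)\subset (S^3)^3$ be the set of triples of distinct points, let $$H:\mathrm{Conf}_3(S^3)\to S^2,\qquad H(x,y,z)=\frac{\mathrm{pr}(x^{-1}y)-\mathrm{pr}(x^{-1}z)}{\|\mathrm{pr}(x^{-1}y)-\mathrm{pr}(x^{-1}z)\|},$$ and let $\omega=H^*\nu\in\Omega^2(\mathrm{Conf}_3(S^3))$, where $\nu$ is the area form of $S^2$. Let $\mathcal T_1,\mathcal T_2,\mathcal T_3\subset S^3$ be pairwise disjoint handlebodies with smooth boundary, and write $\mathcal T=\mathcal T_1\times\mathcal T_2\times\mathcal T_3\subset\mathrm{Conf}_3(S^3)$. Call $\mathcal T$ an *unlinked handlebody* if $\omega$ is exact on $\mathcal T$, i.e. if there is a *potential* $\alpha\in\Omega^1(\mathcal T)$ with $d\alpha=\omega$ on $\mathcal T$. Let $B$ be a smooth vector field on $S^3$ whose flow preserves the volume; call the unlinked handlebody $\mathcal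 T$ *invariant* under $B$ if $B$ is tangent to $\partial\mathcal T_i$ for $i=1,2,3$. Put $B_i=B|_{\mathcal T_i}$, and let $\mu_i$ be the pull-back of $\mu$ under the $i$-th projection $(S^3)^3\to S^3$. For such a pair $(B;\mathcal T)$ and a potential $\alpha$ define $$\mathsf H_{123}(B;\mathcal T)=\int_{\mathcal T}(\alpha\wedge d\alpha)\wedge\iota_{B_1}\mu_1\wedge\iota_{B_2}\mu_2\wedge\iota_{B_3}\mu_3 ,$$ where $(S^3)^3$ is oriented by $\mu_1\wedge\mu_2\wedge\mu_3$. Then the integral converges absolutely and (i) $\mathsf H_{123}(B;\mathcal T)$ does not depend on the choice of the potential $\alpha$ of $\omega$ on $\mathcal T$; (ii) for every volume-preserving diffeomorphism $g$ of $S^3$ that is smoothly isotopic to the identity, $g_*B$ is again a smooth volume-preserving vector field, $g(\mathcal T)=g(\mathcal T_1)\times g(\mathcal T_2)\times g(\mathcal T_3)$ is again an unlinked handlebody, invariant under $g_*B$, and $$\mathsf H_{123}(B;\mathcal T)=\mathsf H_{123}(g_*B;g(\mathcal T)).$$ -/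

import Mathlib

open scoped Manifold ContDiff Quaternion
open MeasureTheory

noncomputable section

namespace Helicity

/-! ### The round three-sphere of unit quaternions and its cube -/

instance instMeasurableSpaceQuaternion : MeasurableSpace ℍ[ℝ] := borel _

instance instBorelSpaceQuaternion : BorelSpace ℍ[ℝ] := ⟨rfl⟩

instance instFactFinrankQuaternion : Fact (Module.finrank ℝ ℍ[ℝ] = 3 + 1) :=
  ⟨Quaternion.finrank_eq_four⟩

/-- The unit sphere `S³` of the quaternions, with Mathlib's smooth structure. -/
abbrev S3 : Type := Metric.sphere (0 : ℍ[ℝ]) 1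

/-- The Riemannian (surface) measure of the round sphere `S³`. -/
def vol : Measure S3 := (volume : Measure ℍ[ℝ]).toSphere

/-- The ambient vector space `ℍ × ℍ × ℍ` of `S³ × S³ × S³`. -/
abbrev Amb : Type := Fin 3 → ℍ[ℝ]

/-- The inclusion `S³ × S³ × S³ → ℍ × ℍ × ℍ`. -/
def incl (p : Fin 3 → S3) : Amb := fun i => (p i : ℍ[ℝ])

/-- The product measure on `S³ × S³ × S³`. -/
def vol3 : Measure (Fin 3 → S3) := Measure.pi fun _ => vol

/-- The product `T₁ × T₂ × T₃`. -/
def prodDomain (T : Fin 3 → Set S3) : Set (Fin 3 → S3) := Set.univ.pi T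

/-- `u` is tangent to `S³ × S³ × S³` at `p`. -/
def IsTangent (p : Fin 3 → S3) (u : Amb) : Prop :=
  ∀ i, inner ℝ (p i : ℍ[ℝ]) (u i) = 0

/-! ### Linear algebra of alternating forms -/

/-- The wedge product of alternating forms (sum over shuffles, no numerical factor). -/
def wedge {V : Type*} [AddCommGroup V] [Module ℝ V] {k l : ℕ}
    (a : V [⋀^Fin k]→ₗ[ℝ] ℝ) (b : V [⋀^Fin l]→ₗ[ℝ] ℝ) : V [⋀^Fin (k + l)]→ₗ[ℝ] ℝ :=
  ((LinearMap.mul' ℝ ℝ).compAlternatingMap (a.domCoprod b)).domDomCongr finSumFinEquiv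

/-- The determinant form of the quaternions, with respect to the basis `1, i, j, k`. -/
def detH : ℍ[ℝ] [⋀^Fin 4]→ₗ[ℝ] ℝ :=
  ((EuclideanSpace.basisFun (Fin 4) ℝ).map Quaternion.linearIsometryEquivTuple.symm).toBasis.det

/-- The volume form `μ` of `S³`: `μ_x(u, v, w) = det(x, u, v, w)` for `u, v, w` tangent at `x`. -/
def volForm (x : S3) : ℍ[ℝ] [⋀^Fin 3]→ₗ[ℝ] ℝ := detH.curryLeft (x : ℍ[ℝ])

/-- The area form `ν` of `S² ⊂ ℝ³`: `ν_n(u, v) = det(n, u, v)` for `u, v` tangent at `n`. -/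
def areaForm (n : EuclideanSpace ℝ (Fin 3)) : EuclideanSpace ℝ (Fin 3) [⋀^Fin 2]→ₗ[ℝ] ℝ :=
  (EuclideanSpace.basisFun (Fin 3) ℝ).toBasis.det.curryLeft n

/-! ### The map `H : Conf₃(S³) → S²` and the two-form `ω = H^* ν` -/

/-- Stereographic projection `S³ ∖ {1} → ℝ³` from `1`, by a formula that makes sense for all
quaternions of real part `≠ 1`. -/
def stereo (q : ℍ[ℝ]) : EuclideanSpace ℝ (Fin 3) :=
  (1 - q.re)⁻¹ • !₂[q.imI, q.imJ, q.imK]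

/-- `pr(x⁻¹ y) - pr(x⁻¹ z)`. -/
def confDiff (p : Amb) : EuclideanSpace ℝ (Fin 3) :=
  stereo ((p 0)⁻¹ * p 1) - stereo ((p 0)⁻¹ * p 2)

/-- The map `H(x, y, z) = (pr(x⁻¹ y) - pr(x⁻¹ z)) / ‖pr(x⁻¹ y) - pr(x⁻¹ z)‖`, given by a formula
that is smooth on a neighbourhood of `Conf₃(S³)` in the ambient space. -/
def confMap (p : Amb) : EuclideanSpace ℝ (Fin 3) := ‖confDiff p‖⁻¹ • confDiff p

/-- The two-form `ω = H^* ν` on `Conf₃(S³)`. -/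
def omega (p : Amb) : Amb [⋀^Fin 2]→ₗ[ℝ] ℝ :=
  (areaForm (confMap p)).compLinearMap (fderiv ℝ confMap p).toLinearMap

/-- `α` is a smooth one-form on `T₁ × T₂ × T₃` with `dα = ω` there. A smooth form on the domain
with corners `T₁ × T₂ × T₃ ⊂ (S³)³ ⊂ ℍ³` is represented by a form that is smooth on a
neighbourhood of it in the ambient space; only values on tangent vectors of `(S³)³` matter, and
`d` commutes with the restriction to `(S³)³`. -/
structure IsPotential (T : Fin 3 → Set S3) (α : Amb → Amb [⋀^Fin 1]→L[ℝ] ℝ) : Prop where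
  smooth : ∃ U : Set Amb, IsOpen U ∧ incl '' prodDomain T ⊆ U ∧ ContDiffOn ℝ ∞ α U
  extDeriv_eq : ∀ p ∈ prodDomain T, ∀ u v : Amb, IsTangent p u → IsTangent p v →
    extDeriv α (incl p) ![u, v] = omega (incl p) ![u, v]

/-! ### Vector fields and diffeomorphisms of `S³` -/

/-- Vector fields on `S³`. -/
abbrev VField : Type := (x : S3) → TangentSpace (𝓡 3) x

/-- `B` is a smooth vector field on `S³` whose flow preserves the volume. -/
structure IsSVect (B : VField) : Prop where
  smooth : ContMDiff (𝓡 3) (𝓡 3).tangent ∞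
    (fun x => (⟨x, B x⟩ : TangentBundle (𝓡 3) S3))
  flow : ∃ Φ : ℝ → S3 → S3, (∀ x, Φ 0 x = x) ∧
    (∀ x, IsMIntegralCurve (I := 𝓡 3) (fun t => Φ t x) B) ∧
    ∀ t, MeasurePreserving (Φ t) vol vol

/-- The value of a vector field on `S³` as a vector of the ambient space `ℍ`. -/
def ambVec (B : VField) (x : S3) : ℍ[ℝ] :=
  mfderiv (𝓡 3) 𝓘(ℝ, ℍ[ℝ]) (fun y : S3 => (y : ℍ[ℝ])) x (B x)

/-- Smooth diffeomorphisms of `S³`. -/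
abbrev DiffS3 : Type := Diffeomorph (𝓡 3) (𝓡 3) S3 S3 ∞

/-- The push-forward `g_* B`, that is, the pull-back of `B` by `g⁻¹`. -/
def pushForward (g : DiffS3) (B : VField) : VField :=
  VectorField.mpullback (𝓡 3) (𝓡 3) g.symm B

/-- `g` is a volume-preserving diffeomorphism that is smoothly isotopic to the identity. (The
diffeomorphisms in the isotopy need not preserve the volume.) -/
structure IsSDiff0 (g : DiffS3) : Prop where
  measurePreserving : MeasurePreserving g vol vol
  isotopic : ∃ G : ℝ → DiffS3,
    ContMDiffOn (𝓘(ℝ, ℝ).prod (𝓡 3)) (𝓡 3) ∞ (fun q : ℝ × S3 => G q.1 q.2)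
      (Set.Icc (0 : ℝ) 1 ×ˢ Set.univ) ∧
    (∀ x, G 0 x = x) ∧ ∀ x, G 1 x = g x

/-! ### Handlebodies in `S³` -/

/-- The model of a handlebody of genus `n`: a closed disc with `n` round holes, times `[0, 1]`. -/
def handlebodyModel (n : ℕ) : Set (ℂ × ℝ) :=
  (Metric.closedBall (0 : ℂ) (4 * (n + 1)) \
    ⋃ k ∈ Finset.Icc 1 n, Metric.ball (4 * (k : ℂ)) 1) ×ˢ Set.Icc (0 : ℝ) 1

/-- On the neighbourhood `U` of the boundary point `x`, the set `T` is `{f ≤ 0}` for a smooth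
function `f` with `f x = 0` and `df_x ≠ 0`. -/
structure IsBoundaryDefining (T : Set S3) (x : S3) (U : Set S3) (f : S3 → ℝ) : Prop where
  isOpen : IsOpen U
  mem : x ∈ U
  smooth : ContMDiffOn (𝓡 3) 𝓘(ℝ, ℝ) ∞ f U
  apply_eq_zero : f x = 0
  mfderiv_ne_zero : mfderiv (𝓡 3) 𝓘(ℝ, ℝ) f x ≠ 0
  mem_iff : ∀ y ∈ U, y ∈ T ↔ f y ≤ 0

/-- `T` is a handlebody in `S³` with smooth boundary. -/
structure IsHandlebody (T : Set S3) : Prop where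
  model : ∃ n : ℕ, Nonempty (T ≃ₜ handlebodyModel n)
  smooth_boundary : ∀ x ∈ frontier T, ∃ (U : Set S3) (f : S3 → ℝ), IsBoundaryDefining T x U f

/-- `B` is tangent to the boundary of `T`. -/
def IsTangentToBoundary (B : VField) (T : Set S3) : Prop :=
  ∀ x ∈ frontier T, ∀ (U : Set S3) (f : S3 → ℝ), IsBoundaryDefining T x U f →
    mfderiv (𝓡 3) 𝓘(ℝ, ℝ) f x (B x) = 0

/-- `T₁ × T₂ × T₃` is an unlinked handlebody, invariant under `B`. -/
structure IsInvariantUnlinkedHandlebody (B : VField) (T : Fin 3 → Set S3) : Prop where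
  disjoint : ∀ i j, i ≠ j → Disjoint (T i) (T j)
  handlebody : ∀ i, IsHandlebody (T i)
  exact : ∃ α, IsPotential T α
  tangent : ∀ i, IsTangentToBoundary B (T i)

/-! ### The helicity -/

/-- The two-form `ι_{B_i} μ_i = π_i^* (ι_B μ)` on `S³ × S³ × S³`. -/
def fluxForm (B : VField) (i : Fin 3) (p : Fin 3 → S3) : Amb [⋀^Fin 2]→ₗ[ℝ] ℝ :=
  ((volForm (p i)).curryLeft (ambVec B (p i))).compLinearMap (LinearMap.proj i)

/-- The nine-form `(α ∧ dα) ∧ ι_{B_1} μ_1 ∧ ι_{B_2} μ_2 ∧ ι_{B_3} μ_3`. -/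
def helicityForm (B : VField) (α : Amb → Amb [⋀^Fin 1]→L[ℝ] ℝ) (p : Fin 3 → S3) :
    Amb [⋀^Fin 9]→ₗ[ℝ] ℝ :=
  wedge (wedge (wedge (wedge (α (incl p)).toAlternatingMap (extDeriv α (incl p)).toAlternatingMap)
    (fluxForm B 0 p)) (fluxForm B 1 p)) (fluxForm B 2 p)

/-- The unit quaternions `i, j, k`. -/
def unitIJK : Fin 3 → ℍ[ℝ] := ![⟨0, 1, 0, 0⟩, ⟨0, 0, 1, 0⟩, ⟨0, 0, 0, 1⟩]

/-- The orthonormal frame `(xi, xj, xk, yi, yj, yk, zi, zj, zk)` of `S³ × S³ × S³` at `(x, y, z)`,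
positively oriented for `μ_1 ∧ μ_2 ∧ μ_3`. -/
def frame (p : Fin 3 → S3) (a : Fin 9) : Amb :=
  let b : Fin 3 × Fin 3 := finProdFinEquiv.symm a
  Pi.single b.1 ((p b.1 : ℍ[ℝ]) * unitIJK b.2)

/-- The density of a nine-form on `S³ × S³ × S³` with respect to the Riemannian volume form
`μ_1 ∧ μ_2 ∧ μ_3`. -/
def density (Θ : (Fin 3 → S3) → Amb [⋀^Fin 9]→ₗ[ℝ] ℝ) (p : Fin 3 → S3) : ℝ := Θ p (frame p)

/-- The integral of a nine-form over a subset of the oriented Riemannian manifold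
`S³ × S³ × S³`. -/
def integralForm (D : Set (Fin 3 → S3)) (Θ : (Fin 3 → S3) → Amb [⋀^Fin 9]→ₗ[ℝ] ℝ) : ℝ :=
  ∫ p in D, density Θ p ∂vol3

/-- The helicity `H₁₂₃(B; T)`, computed with the potential `α`. -/
def helicity (B : VField) (T : Fin 3 → Set S3) (α : Amb → Amb [⋀^Fin 1]→L[ℝ] ℝ) : ℝ :=
  integralForm (prodDomain T) (helicityForm B α)

end Helicity

end

/-!
On `T₁ × T₂ × T₃` the density of the helicity form is `(α ∧ dα)(B₁, B₂, B₃)`, where `Bᵢ` is the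
field `B` acting in the `i`-th factor. The flow of `B` preserves the volume, and it preserves `Tᵢ`
because `B` is tangent to the boundary; hence the integral of a derivative along `Bᵢ` vanishes.
Since the fields `Bᵢ` commute, `∫ (α ∧ dα')(B₁, B₂, B₃)` is therefore symmetric in `α` and `α'`,
and so the helicity depends on `α` only through `dα`.

For an isotopy `G` from the identity to `g`, put `F (t, x) = H (G t x)`, a homotopy of maps to
`S²`. As `ν` is closed, `∂ₜ(Fₜ^* ν) = dηₜ` with `ηₜ = ι_{∂ₜ} F^* ν`, so `Aₜ = α + ∫₀ᵗ ηₛ ds` is a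
primitive of `Fₜ^* ν`. By the symmetry above the derivative of `∫ (Aₜ ∧ dAₜ)(B₁, B₂, B₃)` is
`2 ∫ (ηₜ ∧ Fₜ^* ν)(B₁, B₂, B₃)`, which is zero because `ηₜ ∧ Fₜ^* ν` is the pull-back of
`ι_w ν ∧ ν`, a three-form on a surface. At `t = 1` the form `A₁` is a primitive of `g^* ω`, and it
corresponds under `g` to a potential on `g(T₁) × g(T₂) × g(T₃)`.
-/

noncomputable section

namespace Helicity

open Filter Topology

section Wedge

open Equiv TensorProduct

variable {V : Type*} [AddCommGroup V] [Module ℝ V] {k l : ℕ}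

theorem mk_eq_mk_iff {σ τ : Perm (Fin k ⊕ Fin l)} :
    (QuotientGroup.mk σ : Perm.ModSumCongr (Fin k) (Fin l)) = QuotientGroup.mk τ ↔
      ∀ j, ∃ j', σ (Sum.inr j) = τ (Sum.inr j') := by
  rw [eq_comm, QuotientGroup.eq]
  constructor
  · rintro ⟨⟨s, t⟩, hst⟩ j
    refine ⟨t j, ?_⟩
    rw [← Perm.inv_eq_iff_eq]
    simpa using (Equiv.congr_fun hst (Sum.inr j)).symm
  · intro h
    refine Perm.mem_sumCongrHom_range_of_perm_mapsTo_inl ?_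
    rw [Perm.perm_mapsTo_inl_iff_mapsTo_inr]
    rintro _ ⟨j, rfl⟩
    obtain ⟨j', hj'⟩ := h j
    exact ⟨j', by simp [hj']⟩

/-- The term of the wedge product `a ∧ b` that belongs to the class `q` of permutations modulo
permutations of the two blocks of arguments, that is, to a shuffle. -/
def wedgeSummand (a : V [⋀^Fin k]→ₗ[ℝ] ℝ) (b : V [⋀^Fin l]→ₗ[ℝ] ℝ) (w : Fin k ⊕ Fin l → V)
    (q : Perm.ModSumCongr (Fin k) (Fin l)) : ℝ :=
  LinearMap.mul' ℝ ℝ (AlternatingMap.domCoprod.summand a b q w)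

theorem wedge_apply (a : V [⋀^Fin k]→ₗ[ℝ] ℝ) (b : V [⋀^Fin l]→ₗ[ℝ] ℝ) (v : Fin (k + l) → V) :
    wedge a b v = ∑ q, wedgeSummand a b (v ∘ finSumFinEquiv) q := by
  simp only [wedge, AlternatingMap.domDomCongr_apply, LinearMap.compAlternatingMap_apply,
    AlternatingMap.domCoprod_apply, wedgeSummand, sum_apply, map_sum]

theorem wedgeSummand_mk (a : V [⋀^Fin k]→ₗ[ℝ] ℝ) (b : V [⋀^Fin l]→ₗ[ℝ] ℝ)
    (w : Fin k ⊕ Fin l → V) (σ : Perm (Fin k ⊕ Fin l)) :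
    wedgeSummand a b w (QuotientGroup.mk σ) =
      ((Perm.sign σ : ℤ) : ℝ) * (a (w ∘ σ ∘ Sum.inl) * b (w ∘ σ ∘ Sum.inr)) := by
  have summand_mk : AlternatingMap.domCoprod.summand a b (QuotientGroup.mk σ) w =
      Perm.sign σ • (a (w ∘ σ ∘ Sum.inl) ⊗ₜ[ℝ] b (w ∘ σ ∘ Sum.inr)) :=
    congrArg (· w) (AlternatingMap.domCoprod.summand_mk'' a b σ)
  rw [wedgeSummand, summand_mk, Units.smul_def, ← Int.cast_smul_eq_zsmul ℝ, map_smul,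
    LinearMap.mul'_apply, smul_eq_mul]

/-- The representative of the shuffle that moves `inr j` to the first block in exchange for `inl x`,
and of the trivial shuffle for `none`. -/
def exchange (x : Fin k) : Option (Fin l) → Perm (Fin k ⊕ Fin l)
  | none => 1
  | some j => swap (Sum.inl x) (Sum.inr j)

theorem injective_mk_exchange (x : Fin k) : Function.Injective fun o : Option (Fin l) =>
    (QuotientGroup.mk (exchange x o) : Perm.ModSumCongr (Fin k) (Fin l)) := by
  have mk_some_ne : ∀ j : Fin l, ∀ o, o ≠ some j →
      (QuotientGroup.mk (exchange x (some j)) : Perm.ModSumCongr (Fin k) (Fin l)) ≠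
        QuotientGroup.mk (exchange x o) := by
    intro j o ho h
    obtain ⟨m, hm⟩ := mk_eq_mk_iff.1 h.symm j
    rcases o with - | i
    · rcases eq_or_ne m j with rfl | hmj
      · simp [exchange] at hm
      · rw [exchange, exchange, swap_apply_of_ne_of_ne (by simp) (by simpa using hmj)] at hm
        exact hmj (Sum.inr_injective hm).symm
    · have hij : j ≠ i := fun h => ho (h ▸ rfl)
      rw [exchange, swap_apply_of_ne_of_ne (by simp) (by simpa using hij), exchange] at hm
      rcases eq_or_ne m j with rfl | hmj
      · simp at hm
      · rw [swap_apply_of_ne_of_ne (by simp) (by simpa using hmj)] at hm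
        exact hmj (Sum.inr_injective hm).symm
  rintro (- | i) (- | j) h
  · rfl
  · exact (mk_some_ne j none (by simp) h.symm).elim
  · exact (mk_some_ne i none (by simp) h).elim
  · by_contra hij
    exact mk_some_ne i (some j) (Ne.symm hij) h

theorem exists_mk_exchange_eq (x : Fin k) {σ : Perm (Fin k ⊕ Fin l)}
    (h : ∀ m i, σ (Sum.inr m) = Sum.inl i → i = x) :
    ∃ o, (QuotientGroup.mk (exchange x o) : Perm.ModSumCongr (Fin k) (Fin l)) =
      QuotientGroup.mk σ := by
  simp only [eq_comm (b := (QuotientGroup.mk σ : Perm.ModSumCongr (Fin k) (Fin l))), mk_eq_mk_iff]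
  by_cases hj : ∃ j i, σ (Sum.inl i) = Sum.inr j
  · obtain ⟨j, i, hj⟩ := hj
    refine ⟨some j, fun m => ?_⟩
    rcases hm : σ (Sum.inr m) with i' | j'
    · exact ⟨j, by simp [exchange, h m i' hm]⟩
    · have hne : j' ≠ j := by
        rintro rfl
        simpa using σ.injective (hj.trans hm.symm)
      exact ⟨j', (swap_apply_of_ne_of_ne (by simp) (by simpa using hne)).symm⟩
  · have mapsTo_inl : Set.MapsTo σ (Set.range Sum.inl) (Set.range Sum.inl) := by
      rintro _ ⟨i, rfl⟩
      rcases hi : σ (Sum.inl i) with i' | j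
      · exact ⟨i', rfl⟩
      · exact (hj ⟨j, i, hi⟩).elim
    refine ⟨none, fun m => ?_⟩
    obtain ⟨j, hj⟩ := (Perm.perm_mapsTo_inl_iff_mapsTo_inr σ).1 mapsTo_inl ⟨m, rfl⟩
    exact ⟨j, hj.symm⟩

theorem wedgeSummand_mk_exchange_some (a : V [⋀^Fin k]→ₗ[ℝ] ℝ) (b : V [⋀^Fin l]→ₗ[ℝ] ℝ)
    (v : Fin (k + l) → V) (x : Fin k) (j : Fin l) :
    wedgeSummand a b (v ∘ finSumFinEquiv) (QuotientGroup.mk (exchange x (some j))) =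
      -(a (Function.update (v ∘ Fin.castAdd l) x (v (Fin.natAdd k j))) *
        b (Function.update (v ∘ Fin.natAdd k) j (v (Fin.castAdd l x)))) := by
  have sign_swap : Perm.sign (swap (Sum.inl x) (Sum.inr j) : Perm (Fin k ⊕ Fin l)) = -1 :=
    Perm.sign_swap (by simp)
  have comp_inl : (v ∘ finSumFinEquiv) ∘ exchange x (some j) ∘ Sum.inl =
      Function.update (v ∘ Fin.castAdd l) x (v (Fin.natAdd k j)) := by
    ext i
    rcases eq_or_ne i x with rfl | hi
    · simp [exchange]
    · simp [exchange, hi, swap_apply_of_ne_of_ne]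
  have comp_inr : (v ∘ finSumFinEquiv) ∘ exchange x (some j) ∘ Sum.inr =
      Function.update (v ∘ Fin.natAdd k) j (v (Fin.castAdd l x)) := by
    ext i
    rcases eq_or_ne i j with rfl | hi
    · simp [exchange]
    · simp [exchange, hi, swap_apply_of_ne_of_ne]
  rw [wedgeSummand_mk, comp_inl, comp_inr, exchange, sign_swap]
  simp

theorem wedge_apply_eq_sub_sum (a : V [⋀^Fin k]→ₗ[ℝ] ℝ) (b : V [⋀^Fin l]→ₗ[ℝ] ℝ) (x : Fin k)
    (v : Fin (k + l) → V) (h : ∀ i ≠ x, ∀ (u : Fin l → V) m, u m = v (Fin.castAdd l i) → b u = 0) :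
    wedge a b v = a (v ∘ Fin.castAdd l) * b (v ∘ Fin.natAdd k) -
      ∑ j, a (Function.update (v ∘ Fin.castAdd l) x (v (Fin.natAdd k j))) *
        b (Function.update (v ∘ Fin.natAdd k) j (v (Fin.castAdd l x))) := by
  have summand_eq_zero : ∀ q ∉ Set.range fun o : Option (Fin l) =>
      (QuotientGroup.mk (exchange x o) : Perm.ModSumCongr (Fin k) (Fin l)),
      wedgeSummand a b (v ∘ finSumFinEquiv) q = 0 := by
    intro q hq
    induction q using QuotientGroup.induction_on with | _ σ
    obtain ⟨m, i, hm, hi⟩ : ∃ m i, σ (Sum.inr m) = Sum.inl i ∧ i ≠ x := by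
      by_contra! hσ
      exact hq (exists_mk_exchange_eq x hσ)
    rw [wedgeSummand_mk, h i hi _ m (by simp [hm]), mul_zero, mul_zero]
  have summand_none : wedgeSummand a b (v ∘ finSumFinEquiv) (QuotientGroup.mk (exchange x none)) =
      a (v ∘ Fin.castAdd l) * b (v ∘ Fin.natAdd k) := by
    simp only [wedgeSummand_mk, exchange, Perm.sign_one, Units.val_one, Int.cast_one, one_mul]
    rfl
  rw [wedge_apply, ← Fintype.sum_of_injective _ (injective_mk_exchange x) _ _ summand_eq_zero
    fun _ => rfl, Fintype.sum_option, summand_none, sub_eq_add_neg, ← Finset.sum_neg_distrib]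
  simp only [wedgeSummand_mk_exchange_some]

/-- The value at `(v 0, v 1, v 2)` of the wedge product of a one-form and a two-form, written out
for forms that are not bundled as alternating maps. -/
def wedgeOneTwo {V : Type*} (a : V → ℝ) (b : V → V → ℝ) (v : Fin 3 → V) : ℝ :=
  a (v 0) * b (v 1) (v 2) - a (v 1) * b (v 0) (v 2) + a (v 2) * b (v 0) (v 1)

theorem wedge_one_two_apply (a : V [⋀^Fin 1]→ₗ[ℝ] ℝ) (b : V [⋀^Fin 2]→ₗ[ℝ] ℝ)
    (v : Fin (1 + 2) → V) :
    wedge a b v = wedgeOneTwo (fun u => a ![u]) (fun u w => b ![u, w]) v := by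
  have b_swap : b ![v 1, v 0] = -b ![v 0, v 1] := by
    rw [← b.map_swap ![v 0, v 1] zero_ne_one]
    congr 1
    ext i; fin_cases i <;> rfl
  calc wedge a b v
      = a ![v 0] * b ![v 1, v 2] - (a ![v 1] * b ![v 0, v 2] + a ![v 2] * b ![v 1, v 0]) := by
        rw [wedge_apply_eq_sub_sum a b 0 v fun i hi => absurd (Subsingleton.elim i 0) hi,
          Fin.sum_univ_two]
        congr! <;> ext i <;> fin_cases i <;> rfl
    _ = wedgeOneTwo (fun u => a ![u]) (fun u w => b ![u, w]) v := by
        rw [b_swap, wedgeOneTwo]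
        ring

end Wedge

section Density

theorem unitIJK_coords :
    ((unitIJK 0).re = 0 ∧ (unitIJK 0).imI = 1 ∧ (unitIJK 0).imJ = 0 ∧ (unitIJK 0).imK = 0) ∧
    ((unitIJK 1).re = 0 ∧ (unitIJK 1).imI = 0 ∧ (unitIJK 1).imJ = 1 ∧ (unitIJK 1).imK = 0) ∧
    ((unitIJK 2).re = 0 ∧ (unitIJK 2).imI = 0 ∧ (unitIJK 2).imJ = 0 ∧ (unitIJK 2).imK = 1) :=
  ⟨⟨rfl, rfl, rfl, rfl⟩, ⟨rfl, rfl, rfl, rfl⟩, rfl, rfl, rfl, rfl⟩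

theorem detH_apply (v : Fin 4 → ℍ[ℝ]) :
    detH v = Matrix.det (Matrix.of fun i j => ![(v j).re, (v j).imI, (v j).imJ, (v j).imK] i) := by
  rw [detH, Module.Basis.det_apply]
  congr 1

theorem sum_sq_eq_one (x : S3) : (x : ℍ[ℝ]).re ^ 2 + (x : ℍ[ℝ]).imI ^ 2 + (x : ℍ[ℝ]).imJ ^ 2 +
    (x : ℍ[ℝ]).imK ^ 2 = 1 := by
  rw [← Quaternion.normSq_def', Quaternion.normSq_eq_norm_mul_self]
  simp

theorem volForm_apply_mul (x : S3) {a b c : ℍ[ℝ]} (ha : a.re = 0) (hb : b.re = 0) (hc : c.re = 0) :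
    volForm x ![x * a, x * b, x * c] =
      !![a.imI, b.imI, c.imI; a.imJ, b.imJ, c.imJ; a.imK, b.imK, c.imK].det := by
  have volForm_eq : volForm x ![x * a, x * b, x * c] = detH ![x, x * a, x * b, x * c] := rfl
  calc volForm x ![x * a, x * b, x * c]
      = ((x : ℍ[ℝ]).re ^ 2 + (x : ℍ[ℝ]).imI ^ 2 + (x : ℍ[ℝ]).imJ ^ 2 + (x : ℍ[ℝ]).imK ^ 2) ^ 2 *
          !![a.imI, b.imI, c.imI; a.imJ, b.imJ, c.imJ; a.imK, b.imK, c.imK].det := by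
        rw [volForm_eq, detH_apply, Matrix.det_fin_three]
        simp [Matrix.det_succ_row_zero, Fin.sum_univ_succ, Fin.succAbove, ha, hb, hc]
        ring
    _ = !![a.imI, b.imI, c.imI; a.imJ, b.imJ, c.imJ; a.imK, b.imK, c.imK].det := by
        rw [sum_sq_eq_one, one_pow, one_mul]

theorem exists_eq_mul_of_inner_eq_zero (x : S3) {b : ℍ[ℝ]} (hb : inner ℝ (x : ℍ[ℝ]) b = 0) :
    ∃ c : ℍ[ℝ], c.re = 0 ∧ b = x * c := by
  refine ⟨star (x : ℍ[ℝ]) * b, ?_, ?_⟩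
  · rw [Quaternion.inner_def] at hb
    simp only [Quaternion.re_mul, Quaternion.re_star, Quaternion.imI_star, Quaternion.imJ_star,
      Quaternion.imK_star] at hb ⊢
    linarith
  · rw [← mul_assoc, Quaternion.self_mul_star, Quaternion.normSq_eq_norm_mul_self]
    simp

/-- Cramer's rule in the frame `xi, xj, xk` of the tangent space at `x`. -/
theorem eq_volForm_smul_frame (x : S3) {b : ℍ[ℝ]} (hb : inner ℝ (x : ℍ[ℝ]) b = 0) :
    b = volForm x ![b, x * unitIJK 1, x * unitIJK 2] • ((x : ℍ[ℝ]) * unitIJK 0)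
      - volForm x ![b, x * unitIJK 0, x * unitIJK 2] • ((x : ℍ[ℝ]) * unitIJK 1)
      - volForm x ![b, x * unitIJK 1, x * unitIJK 0] • ((x : ℍ[ℝ]) * unitIJK 2) := by
  obtain ⟨c, hc, rfl⟩ := exists_eq_mul_of_inner_eq_zero x hb
  have re_unitIJK : ∀ i, (unitIJK i).re = 0 := by intro i; fin_cases i <;> rfl
  simp only [volForm_apply_mul x hc (re_unitIJK _) (re_unitIJK _), ← mul_smul_comm, ← mul_sub]
  congr 1
  ext <;> simp [Matrix.det_fin_three, unitIJK_coords, hc]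

theorem inner_coe_ambVec (B : VField) (x : S3) : inner ℝ (x : ℍ[ℝ]) (ambVec B x) = 0 :=
  Submodule.mem_orthogonal_singleton_iff_inner_right.1
    ((range_mvfderiv_subtypeVal x).le ⟨B x, rfl⟩)

theorem fluxForm_apply (B : VField) (i : Fin 3) (p : Fin 3 → S3) (u : Fin 2 → Amb) :
    fluxForm B i p u = volForm (p i) ![ambVec B (p i), u 0 i, u 1 i] := by
  simp only [fluxForm, AlternatingMap.compLinearMap_apply, AlternatingMap.curryLeft_apply_apply]
  congr 1
  ext1 j; fin_cases j <;> rfl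

theorem fluxForm_eq_zero (B : VField) {i : Fin 3} (p : Fin 3 → S3) {u : Fin 2 → Amb} {m : Fin 2}
    (hm : u m i = 0) : fluxForm B i p u = 0 :=
  ((volForm (p i)).curryLeft (ambVec B (p i))).map_coord_zero m hm

/-- The vector field `B` placed in each of the three factors of `S³ × S³ × S³`: the vectors
`(B(x), 0, 0)`, `(0, B(y), 0)` and `(0, 0, B(z))` at the point `p = (x, y, z)`. -/
def slotVec (B : VField) (p : Fin 3 → S3) (i : Fin 3) : Amb := Pi.single i (ambVec B (p i))

theorem wedge_fluxForm_apply {k : ℕ} (a : Amb [⋀^Fin k]→ₗ[ℝ] ℝ) (B : VField) (i : Fin 3)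
    (p : Fin 3 → S3) (x : Fin k) (v : Fin (k + 2) → Amb)
    (hx : v (Fin.castAdd 2 x) = Pi.single i ((p i : ℍ[ℝ]) * unitIJK 0))
    (h0 : v (Fin.natAdd k 0) = Pi.single i ((p i : ℍ[ℝ]) * unitIJK 1))
    (h1 : v (Fin.natAdd k 1) = Pi.single i ((p i : ℍ[ℝ]) * unitIJK 2))
    (h : ∀ j ≠ x, v (Fin.castAdd 2 j) i = 0) :
    wedge a (fluxForm B i p) v = a (Function.update (v ∘ Fin.castAdd 2) x (slotVec B p i)) := by
  have castAdd_eq_update : v ∘ Fin.castAdd 2 =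
      Function.update (v ∘ Fin.castAdd 2) x (v (Fin.castAdd 2 x)) :=
    (Function.update_eq_self x _).symm
  rw [wedge_apply_eq_sub_sum a _ x v
    (fun j hj u m hm => fluxForm_eq_zero B p (m := m) (by rw [hm, h j hj])), Fin.sum_univ_two,
    castAdd_eq_update, slotVec]
  conv_rhs => rw [eq_volForm_smul_frame (p i) (inner_coe_ambVec B (p i))]
  simp only [Pi.single_sub, Pi.single_smul, AlternatingMap.map_update_sub,
    AlternatingMap.map_update_smul, smul_eq_mul, Function.update_idem, fluxForm_apply,
    Function.comp_apply, Function.update_self, Function.update_of_ne, hx, h0, h1, ne_eq,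
    zero_ne_one, one_ne_zero, not_false_eq_true, Pi.single_eq_same]
  ring

theorem wedge_fluxForms_frame (γ : Amb [⋀^Fin 3]→ₗ[ℝ] ℝ) (B : VField) (p : Fin 3 → S3) :
    wedge (wedge (wedge γ (fluxForm B 0 p)) (fluxForm B 1 p)) (fluxForm B 2 p) (frame p) =
      γ (slotVec B p) := by
  let e : Fin 3 → Fin 3 → Amb := fun i j => Pi.single i ((p i : ℍ[ℝ]) * unitIJK j)
  let σ : Equiv.Perm (Fin 9) := c[1, 3] * c[2, 6, 5, 4]
  have frame_eq : frame p = ![e 0 0, e 0 1, e 0 2, e 1 0, e 1 1, e 1 2, e 2 0, e 2 1, e 2 2] := by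
    ext1 a; fin_cases a <;> rfl
  have frame_comp : frame p ∘ σ =
      ![e 0 0, e 1 0, e 2 0, e 0 1, e 0 2, e 1 1, e 1 2, e 2 1, e 2 2] := by
    rw [frame_eq]
    ext1 a; fin_cases a <;> rfl
  have sign_σ : Equiv.Perm.sign σ = 1 := by decide
  rw [← one_smul ℤˣ ((wedge (k := 7) _ (fluxForm B 2 p)) (frame p)), ← sign_σ,
    ← AlternatingMap.map_perm, frame_comp,
    wedge_fluxForm_apply (k := 7) _ B 2 p 2 _ rfl rfl rfl
      (by intro j hj; fin_cases j <;> first | rfl | exact absurd rfl hj),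
    wedge_fluxForm_apply (k := 5) _ B 1 p 1 _ rfl rfl rfl
      (by intro j hj; fin_cases j <;> first | rfl | exact absurd rfl hj),
    wedge_fluxForm_apply (k := 3) _ B 0 p 0 _ rfl rfl rfl
      (by intro j hj; fin_cases j <;> first | rfl | exact absurd rfl hj)]
  congr 1
  ext1 a; fin_cases a <;> rfl

theorem density_helicityForm (B : VField) (α : Amb → Amb [⋀^Fin 1]→L[ℝ] ℝ) (p : Fin 3 → S3) :
    density (helicityForm B α) p =
      wedgeOneTwo (fun u => α (incl p) ![u]) (fun u w => extDeriv α (incl p) ![u, w])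
        (slotVec B p) := by
  rw [density, helicityForm, wedge_fluxForms_frame, wedge_one_two_apply]
  rfl

end Density

section Retraction

open Classical in
/-- The radial retraction `q ↦ q / ‖q‖` of `ℍ ∖ {0}` onto `S³`. Composition with it extends a map
on `S³` to the ambient space; its value at `0` is arbitrary. -/
def retr (q : ℍ[ℝ]) : S3 :=
  if h : q = 0 then ⟨1, by simp⟩ else ⟨‖q‖⁻¹ • q, by simp [norm_smul, h]⟩

theorem coe_retr {q : ℍ[ℝ]} (h : q ≠ 0) : (retr q : ℍ[ℝ]) = ‖q‖⁻¹ • q := by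
  simp [retr, h]

theorem coe_S3_ne_zero (x : S3) : (x : ℍ[ℝ]) ≠ 0 := ne_zero_of_mem_unit_sphere x

@[simp] theorem retr_coe (x : S3) : retr (x : ℍ[ℝ]) = x := by
  apply Subtype.ext
  rw [coe_retr (coe_S3_ne_zero x)]
  simp

theorem contDiffAt_inv_norm_smul {X E : Type*} [NormedAddCommGroup X] [NormedSpace ℝ X]
    [NormedAddCommGroup E] [InnerProductSpace ℝ E] {n : ℕ∞ω} {f : X → E} {x : X}
    (hf : ContDiffAt ℝ n f x) (ne_zero : f x ≠ 0) : ContDiffAt ℝ n (fun x => ‖f x‖⁻¹ • f x) x :=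
  ((hf.norm ℝ ne_zero).inv (norm_ne_zero_iff.2 ne_zero)).smul hf

theorem contMDiffAt_retr {q : ℍ[ℝ]} (hq : q ≠ 0) : ContMDiffAt 𝓘(ℝ, ℍ[ℝ]) (𝓡 3) ∞ retr q := by
  let U : TopologicalSpace.Opens ℍ[ℝ] := ⟨{0}ᶜ, isOpen_compl_singleton⟩
  have contMDiff_normalize :
      ContMDiff 𝓘(ℝ, ℍ[ℝ]) 𝓘(ℝ, ℍ[ℝ]) ∞ fun u : U => ‖(u : ℍ[ℝ])‖⁻¹ • (u : ℍ[ℝ]) := fun u =>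
    (contDiffAt_inv_norm_smul contDiffAt_id u.2).contMDiffAt.comp u (contMDiff_subtype_val u)
  have normalize_mem : ∀ u : U, ‖(u : ℍ[ℝ])‖⁻¹ • (u : ℍ[ℝ]) ∈ Metric.sphere (0 : ℍ[ℝ]) 1 :=
    fun u => by simp [norm_smul, show (u : ℍ[ℝ]) ≠ 0 from u.2]
  have codRestrict_eq : Set.codRestrict _ _ normalize_mem = fun u : U => retr u :=
    funext fun u => Subtype.ext (coe_retr u.2).symm
  have contMDiff_retr := contMDiff_normalize.codRestrict_sphere (n := 3) normalize_mem
  rw [codRestrict_eq] at contMDiff_retr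
  exact contMDiffAt_subtype_iff.1 (contMDiff_retr ⟨q, hq⟩)

variable {E : Type*} [NormedAddCommGroup E] [NormedSpace ℝ E]

theorem contDiffAt_comp_retr {f : S3 → E} {q : ℍ[ℝ]} (hq : q ≠ 0)
    (hf : ContMDiffAt (𝓡 3) 𝓘(ℝ, E) ∞ f (retr q)) : ContDiffAt ℝ ∞ (fun q => f (retr q)) q :=
  (hf.comp q (contMDiffAt_retr hq)).contDiffAt

theorem contMDiff_coe_S3 : ContMDiff (𝓡 3) 𝓘(ℝ, ℍ[ℝ]) ∞ (fun y : S3 => (y : ℍ[ℝ])) :=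
  contMDiff_coe_sphere

theorem mfderiv_eq_fderiv_comp_retr {f : S3 → E} {x : S3}
    (hf : ContMDiffAt (𝓡 3) 𝓘(ℝ, E) ∞ f x) (w : TangentSpace (𝓡 3) x) :
    mfderiv (𝓡 3) 𝓘(ℝ, E) f x w =
      fderiv ℝ (fun q => f (retr q)) x
        (mfderiv (𝓡 3) 𝓘(ℝ, ℍ[ℝ]) (fun y : S3 => (y : ℍ[ℝ])) x w) := by
  have smooth_extension : ContDiffAt ℝ ∞ (fun q => f (retr q)) (x : ℍ[ℝ]) :=
    contDiffAt_comp_retr (coe_S3_ne_zero x) (by rwa [retr_coe])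
  have comp_coe : (fun q => f (retr q)) ∘ (fun y : S3 => (y : ℍ[ℝ])) = f := by
    ext1 y; simp
  have chain_rule := mfderiv_comp x
    (smooth_extension.differentiableAt (by simp)).mdifferentiableAt
    ((contMDiff_coe_S3 x).mdifferentiableAt (by simp))
  rw [comp_coe, mfderiv_eq_fderiv] at chain_rule
  rw [chain_rule]
  rfl

theorem contMDiff_ambVec {B : VField} (hB : IsSVect B) :
    ContMDiff (𝓡 3) 𝓘(ℝ, ℍ[ℝ]) ∞ (ambVec B) := by
  have contMDiff_tangentMap_coe : ContMDiff (𝓡 3).tangent 𝓘(ℝ, ℍ[ℝ]).tangent ∞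
      (tangentMap (𝓡 3) 𝓘(ℝ, ℍ[ℝ]) (fun y : S3 => (y : ℍ[ℝ]))) :=
    contMDiff_coe_S3.contMDiff_tangentMap (by simp)
  exact (contMDiff_snd_tangentBundle_modelSpace ℍ[ℝ] 𝓘(ℝ, ℍ[ℝ])).comp
    (contMDiff_tangentMap_coe.comp hB.smooth)

theorem hasDerivAt_comp_of_hasMFDerivAt {γ : ℝ → S3} {t : ℝ} {w : TangentSpace (𝓡 3) (γ t)}
    (hγ : HasMFDerivAt 𝓘(ℝ, ℝ) (𝓡 3) γ t ((1 : ℝ →L[ℝ] ℝ).smulRight w)) {f : S3 → E}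
    (hf : MDifferentiableAt (𝓡 3) 𝓘(ℝ, E) f (γ t)) :
    HasDerivAt (fun s => f (γ s)) (mfderiv (𝓡 3) 𝓘(ℝ, E) f (γ t) w) t := by
  let L : ℝ →L[ℝ] E := (mfderiv (𝓡 3) 𝓘(ℝ, E) f (γ t)).comp ((1 : ℝ →L[ℝ] ℝ).smulRight w)
  have hasFDerivAt_comp : HasFDerivAt (fun s => f (γ s)) L t :=
    (hf.hasMFDerivAt.comp t hγ).hasFDerivAt
  have L_one : L 1 = mfderiv (𝓡 3) 𝓘(ℝ, E) f (γ t) w :=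
    congrArg (mfderiv (𝓡 3) 𝓘(ℝ, E) f (γ t)) (one_smul ℝ w)
  exact L_one ▸ hasFDerivAt_comp.hasDerivAt

theorem hasDerivAt_coe_integralCurve {B : VField} {γ : ℝ → S3}
    (hγ : IsMIntegralCurve (I := 𝓡 3) γ B) (t : ℝ) :
    HasDerivAt (fun s => (γ s : ℍ[ℝ])) (ambVec B (γ t)) t :=
  hasDerivAt_comp_of_hasMFDerivAt (hγ t) ((contMDiff_coe_S3 (γ t)).mdifferentiableAt (by simp))

end Retraction

section LocalEstimates

variable {E F G : Type*} [NormedAddCommGroup E] [NormedSpace ℝ E] [NormedAddCommGroup F]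
  [NormedSpace ℝ F] [NormedAddCommGroup G]

theorem exists_eventually_dist_le_of_hasStrictFDerivAt [CompleteSpace E] [CompleteSpace F]
    {f : E → F} {f' : E →L[ℝ] F} {a : E} (hf : HasStrictFDerivAt f f' a) (hf' : f'.range = ⊤) :
    ∃ C : ℝ, ∀ᶠ x in 𝓝 a, ∃ z, f z = f a ∧ dist z x ≤ C * dist (f a) (f x) := by
  let R := f'.nonlinearRightInverseOfSurjective hf'
  have R_pos : 0 < R.nnnorm := f'.nonlinearRightInverseOfSurjective_nnnorm_pos hf'
  obtain ⟨s, hs, approximates⟩ :=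
    hf.approximates_deriv_on_nhds (Or.inr (half_pos (inv_pos.2 R_pos)))
  obtain ⟨δ, δ_pos, ball_subset⟩ := Metric.nhds_basis_closedBall.mem_iff.1 hs
  set r : E → ℝ := fun x => 2 * R.nnnorm * dist (f a) (f x)
  have r_tendsto : Tendsto (fun x => r x + dist x a) (𝓝 a) (𝓝 0) := by
    have : ContinuousAt (fun x => r x + dist x a) a :=
      (continuousAt_const.mul (continuousAt_const.dist hf.continuousAt)).add
        (continuousAt_id.dist continuousAt_const)
    simpa only [ContinuousAt, r, dist_self, mul_zero, add_zero] using this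
  refine ⟨2 * R.nnnorm, (r_tendsto.eventually_le_const δ_pos).mono fun x hx => ?_⟩
  have r_nonneg : 0 ≤ r x := by positivity
  have ball_x_subset : Metric.closedBall x (r x) ⊆ s :=
    (Metric.closedBall_subset_closedBall' hx).trans ball_subset
  have radius_eq :
      (((R.nnnorm : ℝ)⁻¹ - (R.nnnorm⁻¹ / 2 : NNReal)) * r x) = dist (f a) (f x) := by
    have : (R.nnnorm : ℝ) ≠ 0 := NNReal.coe_ne_zero.2 R_pos.ne'
    simp only [NNReal.coe_div, NNReal.coe_inv, NNReal.coe_ofNat, r]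
    field_simp
    ring
  obtain ⟨z, hz, fz⟩ := approximates.surjOn_closedBall_of_nonlinearRightInverse R r_nonneg
    ball_x_subset (Metric.mem_closedBall.2 radius_eq.ge)
  exact ⟨z, fz, hz⟩

theorem exists_eventually_norm_le_mul_norm_of_hasStrictFDerivAt [CompleteSpace E] [CompleteSpace F]
    {f : E → F} {f' : E →L[ℝ] F} {a : E} (hf : HasStrictFDerivAt f f' a) (hf' : f'.range = ⊤)
    {h : E → G} {K : NNReal} {s : Set E} (hs : s ∈ 𝓝 a) (hh : LipschitzOnWith K h s)
    (h_zero : ∀ᶠ x in 𝓝 a, f x = f a → h x = 0) :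
    ∃ C : ℝ, ∀ᶠ x in 𝓝 a, ‖h x‖ ≤ C * ‖f x - f a‖ := by
  obtain ⟨C, hC⟩ := exists_eventually_dist_le_of_hasStrictFDerivAt hf hf'
  obtain ⟨δ, δ_pos, ball_subset⟩ := Metric.mem_nhds_iff.1 (inter_mem hs h_zero)
  have near_tendsto : Tendsto (fun x => C * dist (f a) (f x) + dist x a) (𝓝 a) (𝓝 0) := by
    have : ContinuousAt (fun x => C * dist (f a) (f x) + dist x a) a :=
      (continuousAt_const.mul (continuousAt_const.dist hf.continuousAt)).add
        (continuousAt_id.dist continuousAt_const)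
    simpa only [ContinuousAt, dist_self, mul_zero, add_zero] using this
  refine ⟨K * C, ?_⟩
  filter_upwards [hC, hs, near_tendsto.eventually_lt_const δ_pos] with x ⟨z, fz, hzx⟩ hx hδ
  have hz : z ∈ Metric.ball a δ :=
    Metric.mem_ball.2 ((dist_triangle z x a).trans_lt ((add_le_add_left hzx _).trans_lt hδ))
  calc ‖h x‖ = dist (h x) (h z) := by rw [(ball_subset hz).2 fz, dist_zero_right]
    _ ≤ K * dist x z := hh.dist_le_mul x hx z (ball_subset hz).1
    _ ≤ K * (C * dist (f a) (f x)) := by rw [dist_comm x z]; gcongr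
    _ = K * C * ‖f x - f a‖ := by rw [dist_comm (f a), dist_eq_norm]; ring

theorem eventually_eq_zero_of_norm_deriv_le {u u' : ℝ → E} {t₀ C : ℝ}
    (hu : ∀ᶠ t in 𝓝 t₀, HasDerivAt u (u' t) t ∧ ‖u' t‖ ≤ C * ‖u t‖) (h₀ : u t₀ = 0) :
    ∀ᶠ t in 𝓝 t₀, u t = 0 := by
  obtain ⟨δ, δ_pos, on_ball⟩ := Metric.eventually_nhds_iff_ball.1 hu
  have one_sided : ∀ σ : ℝ, |σ| = 1 → ∀ r < δ, ∀ s ∈ Set.Icc 0 r, u (t₀ + σ * s) = 0 := by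
    intro σ hσ r hr
    have near : ∀ s ∈ Set.Icc 0 r, t₀ + σ * s ∈ Metric.ball t₀ δ := fun s hs => by
      rw [Metric.mem_ball, Real.dist_eq, add_sub_cancel_left, abs_mul, hσ, one_mul,
        abs_of_nonneg hs.1]
      exact hs.2.trans_lt hr
    have deriv_reparam : ∀ s ∈ Set.Icc 0 r,
        HasDerivAt (fun s => u (t₀ + σ * s)) (σ • u' (t₀ + σ * s)) s := fun s hs =>
      (on_ball _ (near s hs)).1.scomp s (by
        simpa using ((hasDerivAt_id s).const_mul σ).const_add t₀)
    refine eq_zero_of_abs_deriv_le_mul_abs_self_of_eq_zero_right (K := C)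
      (fun s hs => (deriv_reparam s hs).continuousAt.continuousWithinAt)
      (fun s hs => (deriv_reparam s (Set.Ico_subset_Icc_self hs)).hasDerivWithinAt)
      (by simpa using h₀) fun s hs => ?_
    rw [norm_smul, Real.norm_eq_abs, hσ, one_mul]
    exact (on_ball _ (near s (Set.Ico_subset_Icc_self hs))).2
  filter_upwards [Metric.ball_mem_nhds t₀ δ_pos] with t ht
  rw [Metric.mem_ball, Real.dist_eq] at ht
  rcases le_total t₀ t with le | le
  · simpa [abs_of_nonneg (sub_nonneg.2 le)] using
      one_sided 1 (by simp) _ ht |t - t₀| ⟨abs_nonneg _, le_rfl⟩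
  · simpa [abs_of_nonpos (sub_nonpos.2 le)] using
      one_sided (-1) (by simp) _ ht |t - t₀| ⟨abs_nonneg _, le_rfl⟩

end LocalEstimates

section FlowInvariance

/-- The complete integral curves of the vector field `B` that start in `S` stay in `S`. -/
def IsFlowInvariant (B : VField) (S : Set S3) : Prop :=
  ∀ γ : ℝ → S3, IsMIntegralCurve (I := 𝓡 3) γ B → γ 0 ∈ S → ∀ t, γ t ∈ S

/-- The derivative of the function `f` on `S³` along the vector field `B`. -/
def derivAlong (B : VField) (f : S3 → ℝ) (x : S3) : ℝ := mfderiv (𝓡 3) 𝓘(ℝ, ℝ) f x (B x)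

theorem tendsto_retr_nhds (x : S3) : Tendsto retr (𝓝 (x : ℍ[ℝ])) (𝓝 x) := by
  simpa only [retr_coe] using (contMDiffAt_retr (coe_S3_ne_zero x)).continuousAt.tendsto

variable {f : S3 → ℝ} {x : S3}

theorem fderiv_comp_retr_eq_zero_iff (hf : ContMDiffAt (𝓡 3) 𝓘(ℝ, ℝ) ∞ f x) :
    fderiv ℝ (fun q => f (retr q)) x = 0 ↔ mfderiv (𝓡 3) 𝓘(ℝ, ℝ) f x = 0 := by
  constructor <;> intro h
  · ext w
    rw [mfderiv_eq_fderiv_comp_retr hf, h]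
    rfl
  · have chain_rule := mfderiv_comp_of_eq (I'' := 𝓘(ℝ, ℝ)) (hf.mdifferentiableAt (by simp))
      ((contMDiffAt_retr (coe_S3_ne_zero x)).mdifferentiableAt (by simp)) (retr_coe x)
    rw [← retr_coe x] at h
    rw [mfderiv_eq_fderiv, h] at chain_rule
    exact chain_rule.trans (ContinuousLinearMap.zero_comp _)

theorem eventually_mfderiv_ne_zero (hf : ∀ᶠ y in 𝓝 x, ContMDiffAt (𝓡 3) 𝓘(ℝ, ℝ) ∞ f y)
    (hdf : mfderiv (𝓡 3) 𝓘(ℝ, ℝ) f x ≠ 0) :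
    ∀ᶠ y in 𝓝 x, mfderiv (𝓡 3) 𝓘(ℝ, ℝ) f y ≠ 0 := by
  have smooth_extension : ContDiffAt ℝ ∞ (fun q => f (retr q)) (x : ℍ[ℝ]) :=
    contDiffAt_comp_retr (coe_S3_ne_zero x) (by rw [retr_coe]; exact hf.self_of_nhds)
  have continuousAt_fderiv :
      ContinuousAt (fun y : S3 => fderiv ℝ (fun q => f (retr q)) (y : ℍ[ℝ])) x :=
    ContinuousAt.comp (g := fderiv ℝ fun q => f (retr q)) (f := fun y : S3 => (y : ℍ[ℝ]))
      (smooth_extension.fderiv_right (m := ∞) (by simp)).continuousAt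
      continuous_subtype_val.continuousAt
  filter_upwards [hf, continuousAt_fderiv.eventually_ne
    (mt (fderiv_comp_retr_eq_zero_iff hf.self_of_nhds).1 hdf)] with y hy ne
  exact mt (fderiv_comp_retr_eq_zero_iff hy).2 ne

theorem IsSVect.contMDiffAt_derivAlong {B : VField} (hB : IsSVect B)
    (hf : ∀ᶠ y in 𝓝 x, ContMDiffAt (𝓡 3) 𝓘(ℝ, ℝ) ∞ f y) :
    ContMDiffAt (𝓡 3) 𝓘(ℝ, ℝ) ∞ (derivAlong B f) x := by
  have smooth_extension : ContDiffAt ℝ ∞ (fun q => f (retr q)) (x : ℍ[ℝ]) :=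
    contDiffAt_comp_retr (coe_S3_ne_zero x) (by rw [retr_coe]; exact hf.self_of_nhds)
  have contMDiffAt_fderiv : ContMDiffAt (𝓡 3) 𝓘(ℝ, ℍ[ℝ] →L[ℝ] ℝ) ∞
      (fun y : S3 => fderiv ℝ (fun q => f (retr q)) (y : ℍ[ℝ])) x :=
    ContMDiffAt.comp (g := fderiv ℝ fun q => f (retr q)) (f := fun y : S3 => (y : ℍ[ℝ])) x
      (smooth_extension.fderiv_right (m := ∞) (by simp)).contMDiffAt (contMDiff_coe_S3 x)
  refine (contMDiffAt_fderiv.clm_apply (contMDiff_ambVec hB x)).congr_of_eventuallyEq ?_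
  filter_upwards [hf] with y hy
  exact mfderiv_eq_fderiv_comp_retr hy (B y)

variable {B : VField} {S U : Set S3}

namespace IsBoundaryDefining

theorem eventually_contMDiffAt (hf : IsBoundaryDefining S x U f) :
    ∀ᶠ y in 𝓝 x, ContMDiffAt (𝓡 3) 𝓘(ℝ, ℝ) ∞ f y :=
  (hf.isOpen.eventually_mem hf.mem).mono fun _ hy => hf.smooth.contMDiffAt (hf.isOpen.mem_nhds hy)

theorem contMDiffAt (hf : IsBoundaryDefining S x U f) : ContMDiffAt (𝓡 3) 𝓘(ℝ, ℝ) ∞ f x :=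
  hf.eventually_contMDiffAt.self_of_nhds

theorem mem_frontier (hf : IsBoundaryDefining S x U f) : x ∈ frontier S := by
  refine ⟨subset_closure ((hf.mem_iff x hf.mem).2 hf.apply_eq_zero.le), fun x_mem => ?_⟩
  refine mt (fderiv_comp_retr_eq_zero_iff hf.contMDiffAt).1 hf.mfderiv_ne_zero
    (IsLocalMax.fderiv_eq_zero ?_)
  filter_upwards [(tendsto_retr_nhds x).eventually (hf.isOpen.mem_nhds hf.mem),
    (tendsto_retr_nhds x).eventually (mem_interior_iff_mem_nhds.1 x_mem)] with q hqU hqS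
  simpa only [retr_coe, hf.apply_eq_zero] using (hf.mem_iff _ hqU).1 hqS

theorem eventually_of_apply_eq_zero (hf : IsBoundaryDefining S x U f) :
    ∀ᶠ y in 𝓝 x, f y = 0 → IsBoundaryDefining S y U f := by
  filter_upwards [hf.isOpen.mem_nhds hf.mem,
    eventually_mfderiv_ne_zero hf.eventually_contMDiffAt hf.mfderiv_ne_zero] with y hyU hdf hy
  exact ⟨hf.isOpen, hyU, hf.smooth, hy, hdf, hf.mem_iff⟩

/- Tangency makes the derivative of `f` along `B` vanish on the regular hypersurface `{f = 0}`;
hence it is locally bounded by a multiple of `f`. -/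
theorem exists_eventually_norm_derivAlong_le (hf : IsBoundaryDefining S x U f) (hB : IsSVect B)
    (hS : IsTangentToBoundary B S) :
    ∃ C : ℝ, ∀ᶠ y in 𝓝 x, ‖derivAlong B f y‖ ≤ C * ‖f y‖ := by
  have smooth_f : ContDiffAt ℝ ∞ (fun q => f (retr q)) (x : ℍ[ℝ]) :=
    contDiffAt_comp_retr (coe_S3_ne_zero x) (by rw [retr_coe]; exact hf.contMDiffAt)
  have smooth_deriv : ContDiffAt ℝ ∞ (fun q => derivAlong B f (retr q)) (x : ℍ[ℝ]) :=
    contDiffAt_comp_retr (coe_S3_ne_zero x)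
      (by rw [retr_coe]; exact hB.contMDiffAt_derivAlong hf.eventually_contMDiffAt)
  have surjective : (fderiv ℝ (fun q => f (retr q)) (x : ℍ[ℝ])).range = ⊤ :=
    Module.Dual.range_eq_top_of_ne_zero fun h =>
      mt (fderiv_comp_retr_eq_zero_iff hf.contMDiffAt).1 hf.mfderiv_ne_zero
        (ContinuousLinearMap.coe_injective h)
  obtain ⟨K, s, hs, lipschitz⟩ := (smooth_deriv.of_le (m := 1) (by simp)).exists_lipschitzOnWith
  have deriv_zero : ∀ᶠ y in 𝓝 x, f y = 0 → derivAlong B f y = 0 :=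
    hf.eventually_of_apply_eq_zero.mono fun y hy h => hS y (hy h).mem_frontier U f (hy h)
  obtain ⟨C, hC⟩ := exists_eventually_norm_le_mul_norm_of_hasStrictFDerivAt
    (smooth_f.hasStrictFDerivAt (by simp)) surjective hs lipschitz
    (by simpa only [retr_coe, hf.apply_eq_zero] using (tendsto_retr_nhds x).eventually deriv_zero)
  refine ⟨C, (continuous_subtype_val.tendsto x |>.eventually hC).mono fun y hy => ?_⟩
  simpa only [retr_coe, hf.apply_eq_zero, sub_zero] using hy

theorem eventually_apply_integralCurve_eq_zero {γ : ℝ → S3} {t₀ : ℝ}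
    (hf : IsBoundaryDefining S (γ t₀) U f) (hB : IsSVect B) (hS : IsTangentToBoundary B S)
    (hγ : IsMIntegralCurve (I := 𝓡 3) γ B) : ∀ᶠ t in 𝓝 t₀, f (γ t) = 0 := by
  obtain ⟨C, hC⟩ := hf.exists_eventually_norm_derivAlong_le hB hS
  refine eventually_eq_zero_of_norm_deriv_le
    (u' := fun t => derivAlong B f (γ t)) (C := C) ?_ hf.apply_eq_zero
  filter_upwards [hγ.continuous.continuousAt.eventually hC,
    hγ.continuous.continuousAt (hf.isOpen.mem_nhds hf.mem)] with t bound htU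
  exact ⟨hasDerivAt_comp_of_hasMFDerivAt (hγ t)
    ((hf.smooth.contMDiffAt (hf.isOpen.mem_nhds htU)).mdifferentiableAt (by simp)), bound⟩

end IsBoundaryDefining

theorem IsTangentToBoundary.isFlowInvariant (hS : IsTangentToBoundary B S) (hB : IsSVect B)
    (isClosed : IsClosed S)
    (smooth_boundary : ∀ x ∈ frontier S, ∃ (U : Set S3) (f : S3 → ℝ), IsBoundaryDefining S x U f) :
    IsFlowInvariant B S := by
  intro γ hγ mem_zero t
  have isClopen : IsClopen (γ ⁻¹' S) := by
    refine ⟨isClosed.preimage hγ.continuous, isOpen_iff_mem_nhds.2 fun t₀ mem => ?_⟩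
    by_cases mem_interior : γ t₀ ∈ interior S
    · exact hγ.continuous.continuousAt (mem_interior_iff_mem_nhds.1 mem_interior)
    · obtain ⟨U, f, hf⟩ := smooth_boundary _ ⟨subset_closure mem, mem_interior⟩
      filter_upwards [hf.eventually_apply_integralCurve_eq_zero hB hS hγ,
        hγ.continuous.continuousAt (hf.isOpen.mem_nhds hf.mem)] with t ht htU
      exact (hf.mem_iff _ htU).2 ht.le
  exact (isClopen.eq_univ ⟨0, mem_zero⟩).ge (Set.mem_univ t)

end FlowInvariance

section VolumePreservingFlow

theorem measurePreserving_restrict_of_mapsTo {X : Type*} [MeasurableSpace X] {μ : Measure X}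
    [IsFiniteMeasure μ] {f : X → X} (hf : MeasurePreserving f μ μ) {s : Set X}
    (hs : MeasurableSet s) (hfs : Set.MapsTo f s s) :
    MeasurePreserving f (μ.restrict s) (μ.restrict s) := by
  have preimage_ae_eq : f ⁻¹' s =ᵐ[μ] s :=
    (ae_eq_of_subset_of_measure_ge hfs (hf.measure_preimage hs.nullMeasurableSet).le
      hs.nullMeasurableSet (measure_ne_top _ _)).symm
  simpa only [Measure.restrict_congr_set preimage_ae_eq] using hf.restrict_preimage hs

theorem integral_eq_zero_of_hasDerivAt_measurePreserving {X E : Type*} [MeasurableSpace X]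
    [NormedAddCommGroup E] [NormedSpace ℝ E] {μ : Measure X} [IsFiniteMeasure μ] {Ψ : ℝ → X → X}
    (measurePreserving : ∀ t, MeasurePreserving (Ψ t) μ μ) (Ψ_zero : ∀ x, Ψ 0 x = x)
    {f f' : X → E} (hf : Integrable f μ) (hf' : AEStronglyMeasurable f' μ) {C : ℝ}
    (bound : ∀ᵐ x ∂μ, ∀ t, ‖f' (Ψ t x)‖ ≤ C)
    (hasDerivAt : ∀ᵐ x ∂μ, ∀ t, HasDerivAt (fun s => f (Ψ s x)) (f' (Ψ t x)) t) :
    ∫ x, f' x ∂μ = 0 := by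
  have integral_comp (t : ℝ) : ∫ x, f (Ψ t x) ∂μ = ∫ x, f x ∂μ := by
    have map_eq := (measurePreserving t).map_eq
    rw [← integral_map (measurePreserving t).measurable.aemeasurable
      (by rw [map_eq]; exact hf.aestronglyMeasurable), map_eq]
  have hasDerivAt_integral := (hasDerivAt_integral_of_dominated_loc_of_deriv_le
    (bound := fun _ => C) (F := fun t x => f (Ψ t x)) (x₀ := 0) univ_mem
    (Eventually.of_forall fun t => hf.aestronglyMeasurable.comp_measurePreserving
      (measurePreserving t))
    ((measurePreserving 0).integrable_comp_of_integrable hf)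
    (hf'.comp_measurePreserving (measurePreserving 0))
    (bound.mono fun x hx t _ => hx t) (integrable_const C)
    (hasDerivAt.mono fun x hx t _ => hx t)).2
  simp only [integral_comp, Ψ_zero] at hasDerivAt_integral
  exact hasDerivAt_integral.unique (hasDerivAt_const _ _)

instance : IsFiniteMeasure vol := by unfold vol; infer_instance

instance : IsFiniteMeasure vol3 := by unfold vol3; infer_instance

theorem continuous_incl : Continuous incl := by unfold incl; fun_prop

/-- `f` is smooth near the points of `T₁ × T₂ × T₃ ⊂ ℍ × ℍ × ℍ`. -/
def SmoothAlong {E : Type*} [NormedAddCommGroup E] [NormedSpace ℝ E] (T : Fin 3 → Set S3)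
    (f : Amb → E) : Prop :=
  ∀ p ∈ prodDomain T, ContDiffAt ℝ ∞ f (incl p)

/-- The map of `S³ × S³ × S³` that moves the `i`-th factor for time `t` under the flow `Φ`. -/
def slotFlow (Φ : ℝ → S3 → S3) (i : Fin 3) (t : ℝ) (p : Fin 3 → S3) : Fin 3 → S3 :=
  fun j => (if j = i then Φ t else id) (p j)

variable {B : VField} {T : Fin 3 → Set S3} {Φ : ℝ → S3 → S3} {i : Fin 3}

theorem isCompact_prodDomain (hT : ∀ i, IsCompact (T i)) : IsCompact (prodDomain T) :=
  isCompact_univ_pi hT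

theorem measurableSet_prodDomain (hT : ∀ i, IsCompact (T i)) : MeasurableSet (prodDomain T) :=
  (isCompact_prodDomain hT).isClosed.measurableSet

theorem slotFlow_zero (hΦ : ∀ x, Φ 0 x = x) (p : Fin 3 → S3) : slotFlow Φ i 0 p = p := by
  ext1 j
  by_cases hj : j = i <;> simp [slotFlow, hj, hΦ]

theorem mapsTo_slotFlow {t : ℝ} (h : Set.MapsTo (Φ t) (T i) (T i)) :
    Set.MapsTo (slotFlow Φ i t) (prodDomain T) (prodDomain T) := by
  intro p hp j _
  by_cases hj : j = i
  · subst hj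
    simpa [slotFlow] using h (hp j trivial)
  · simpa [slotFlow, hj] using hp j trivial

theorem measurePreserving_slotFlow {t : ℝ} (h : MeasurePreserving (Φ t) vol vol) :
    MeasurePreserving (slotFlow Φ i t) vol3 vol3 := by
  refine measurePreserving_pi _ _ fun j => ?_
  by_cases hj : j = i
  · simpa [hj] using h
  · simpa [hj] using MeasurePreserving.id vol

theorem hasDerivAt_incl_slotFlow (hΦ : ∀ x, IsMIntegralCurve (I := 𝓡 3) (fun t => Φ t x) B)
    (t : ℝ) (p : Fin 3 → S3) :
    HasDerivAt (fun s => incl (slotFlow Φ i s p)) (slotVec B (slotFlow Φ i t p) i) t := by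
  rw [hasDerivAt_pi]
  intro j
  by_cases hj : j = i
  · subst hj
    simpa [incl, slotFlow, slotVec] using hasDerivAt_coe_integralCurve (hΦ (p j)) t
  · simpa [incl, slotFlow, slotVec, hj] using hasDerivAt_const t (p j : ℍ[ℝ])

theorem IsSVect.continuous_slotVec (hB : IsSVect B) (i : Fin 3) :
    Continuous fun p => slotVec B p i :=
  (continuous_single i).comp ((contMDiff_ambVec hB).continuous.comp (continuous_apply i))

variable {E : Type*} [NormedAddCommGroup E] [NormedSpace ℝ E] {f : Amb → E}

theorem SmoothAlong.continuousOn (hf : SmoothAlong T f) :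
    ContinuousOn (fun p => f (incl p)) (prodDomain T) := fun p hp =>
  (ContinuousAt.comp (f := incl) (hf p hp).continuousAt
    continuous_incl.continuousAt).continuousWithinAt

theorem SmoothAlong.continuousOn_fderiv_slotVec (hf : SmoothAlong T f) (hB : IsSVect B)
    (i : Fin 3) :
    ContinuousOn (fun p => fderiv ℝ f (incl p) (slotVec B p i)) (prodDomain T) :=
  SmoothAlong.continuousOn (f := fderiv ℝ f)
    (fun p hp => (hf p hp).fderiv_right (m := ∞) (by simp)) |>.clm_apply
    (hB.continuous_slotVec i).continuousOn

theorem SmoothAlong.integral_fderiv_slotVec (hf : SmoothAlong T f) (hB : IsSVect B)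
    (hT : ∀ i, IsCompact (T i)) (hBT : IsFlowInvariant B (T i)) :
    ∫ p in prodDomain T, fderiv ℝ f (incl p) (slotVec B p i) ∂vol3 = 0 := by
  obtain ⟨Φ, Φ_zero, hΦ, Φ_measurePreserving⟩ := hB.flow
  have mapsTo (t : ℝ) : Set.MapsTo (slotFlow Φ i t) (prodDomain T) (prodDomain T) :=
    mapsTo_slotFlow fun x hx => hBT _ (hΦ x) (by rwa [Φ_zero]) t
  have measurable := measurableSet_prodDomain hT
  have continuous_deriv := hf.continuousOn_fderiv_slotVec hB i
  obtain ⟨C, hC⟩ := (isCompact_prodDomain hT).exists_bound_of_continuousOn continuous_deriv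
  exact integral_eq_zero_of_hasDerivAt_measurePreserving (f := fun p => f (incl p))
    (fun t => measurePreserving_restrict_of_mapsTo
      (measurePreserving_slotFlow (Φ_measurePreserving t)) measurable (mapsTo t))
    (slotFlow_zero Φ_zero)
    (hf.continuousOn.integrableOn_compact (isCompact_prodDomain hT))
    (continuous_deriv.aestronglyMeasurable measurable)
    (ae_restrict_of_forall_mem measurable fun p hp t => hC _ (mapsTo t hp))
    (ae_restrict_of_forall_mem measurable fun p hp t =>
      ((hf _ (mapsTo t hp)).differentiableAt (by simp)).hasFDerivAt.comp_hasDerivAt t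
        (hasDerivAt_incl_slotFlow hΦ t p))

end VolumePreservingFlow

section OneForms

/-- The exterior derivative `(dA)_x(u, v)` of a one-form, given as a map to the dual space. -/
def extDerivOne {E : Type*} [NormedAddCommGroup E] [NormedSpace ℝ E] (A : E → E →L[ℝ] ℝ)
    (x u v : E) : ℝ :=
  fderiv ℝ A x u v - fderiv ℝ A x v u

/-- The extension of `fun p => slotVec B p i` to a vector field on a dense open subset of the
ambient space. -/
def slotField (B : VField) (i : Fin 3) (q : Amb) : Amb := Pi.single i (ambVec B (retr (q i)))

/-- The value of `A ∧ dA'` on the three vector fields `slotVec B`. -/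
def wedgeSlots (B : VField) (A A' : Amb → Amb →L[ℝ] ℝ) (p : Fin 3 → S3) : ℝ :=
  wedgeOneTwo (A (incl p)) (extDerivOne A' (incl p)) (slotVec B p)

/-- The value of `A ∧ A'` on the vector fields `slotField B i` and `slotField B j`. -/
def wedgeSlotFields (B : VField) (A A' : Amb → Amb →L[ℝ] ℝ) (i j : Fin 3) (q : Amb) : ℝ :=
  A q (slotField B i q) * A' q (slotField B j q) - A q (slotField B j q) * A' q (slotField B i q)

theorem continuousOn_wedgeOneTwo {X V : Type*} [TopologicalSpace X] {s : Set X} {a : X → V → ℝ}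
    {b : X → V → V → ℝ} {v : X → Fin 3 → V} (ha : ∀ i, ContinuousOn (fun x => a x (v x i)) s)
    (hb : ∀ i j, ContinuousOn (fun x => b x (v x i) (v x j)) s) :
    ContinuousOn (fun x => wedgeOneTwo (a x) (b x) (v x)) s :=
  (((ha 0).mul (hb 1 2)).sub ((ha 1).mul (hb 0 2))).add ((ha 2).mul (hb 0 1))

variable {B : VField} {T : Fin 3 → Set S3} {A A' : Amb → Amb →L[ℝ] ℝ}

theorem slotField_incl (p : Fin 3 → S3) (i : Fin 3) : slotField B i (incl p) = slotVec B p i := by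
  simp [slotField, slotVec, incl]

theorem IsSVect.contDiffAt_slotField (hB : IsSVect B) (p : Fin 3 → S3) (i : Fin 3) :
    ContDiffAt ℝ ∞ (slotField B i) (incl p) := by
  have contDiffAt_comp_proj : ContDiffAt ℝ ∞ (fun q : Amb => ambVec B (retr (q i))) (incl p) :=
    (contDiffAt_comp_retr (coe_S3_ne_zero (p i)) (contMDiff_ambVec hB _)).comp (incl p)
      (contDiff_apply ℝ ℍ[ℝ] i).contDiffAt
  exact (ContinuousLinearMap.single ℝ (fun _ : Fin 3 => ℍ[ℝ]) i).contDiff.contDiffAt.comp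
    (incl p) contDiffAt_comp_proj

theorem fderiv_slotField_slotVec (hB : IsSVect B) (p : Fin 3 → S3) {i j : Fin 3} (hij : i ≠ j) :
    fderiv ℝ (slotField B j) (incl p) (slotVec B p i) = 0 := by
  have constant_along : ∀ t : ℝ, slotField B j (incl p + t • slotVec B p i) =
      slotField B j (incl p) := fun t => by simp [slotField, slotVec, hij.symm]
  rw [← ((hB.contDiffAt_slotField p j).differentiableAt (by simp)).lineDeriv_eq_fderiv, lineDeriv]
  simp only [constant_along, deriv_const']

theorem fderiv_apply_slotField (hB : IsSVect B) {p : Fin 3 → S3}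
    (hA : DifferentiableAt ℝ A (incl p)) {i j : Fin 3} (hij : i ≠ j) :
    fderiv ℝ (fun q => A q (slotField B j q)) (incl p) (slotVec B p i) =
      fderiv ℝ A (incl p) (slotVec B p i) (slotVec B p j) := by
  have hasFDerivAt_slotField :=
    ((hB.contDiffAt_slotField p j).differentiableAt (by simp)).hasFDerivAt
  rw [(hA.hasFDerivAt.clm_apply hasFDerivAt_slotField).fderiv]
  simp [slotField_incl, fderiv_slotField_slotVec hB p hij]

theorem continuousOn_apply_slotVec (hB : IsSVect B) (hA : SmoothAlong T A) (i : Fin 3) :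
    ContinuousOn (fun p => A (incl p) (slotVec B p i)) (prodDomain T) :=
  hA.continuousOn.clm_apply (hB.continuous_slotVec i).continuousOn

theorem continuousOn_extDerivOne_slotVec (hB : IsSVect B) (hA : SmoothAlong T A) (i j : Fin 3) :
    ContinuousOn (fun p => extDerivOne A (incl p) (slotVec B p i) (slotVec B p j))
      (prodDomain T) :=
  ((hA.continuousOn_fderiv_slotVec hB i).clm_apply (hB.continuous_slotVec j).continuousOn).sub
    ((hA.continuousOn_fderiv_slotVec hB j).clm_apply (hB.continuous_slotVec i).continuousOn)

theorem continuousOn_wedgeSlots (hB : IsSVect B) (hA : SmoothAlong T A)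
    (hA' : SmoothAlong T A') : ContinuousOn (wedgeSlots B A A') (prodDomain T) :=
  continuousOn_wedgeOneTwo (continuousOn_apply_slotVec hB hA)
    (continuousOn_extDerivOne_slotVec hB hA')

theorem smoothAlong_wedgeSlotFields (hB : IsSVect B) (hA : SmoothAlong T A)
    (hA' : SmoothAlong T A') (i j : Fin 3) : SmoothAlong T (wedgeSlotFields B A A' i j) :=
  fun p hp =>
    (((hA p hp).clm_apply (hB.contDiffAt_slotField p i)).mul
      ((hA' p hp).clm_apply (hB.contDiffAt_slotField p j))).sub
    (((hA p hp).clm_apply (hB.contDiffAt_slotField p j)).mul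
      ((hA' p hp).clm_apply (hB.contDiffAt_slotField p i)))

theorem fderiv_wedgeSlotFields_slotVec (hB : IsSVect B) {p : Fin 3 → S3}
    (hA : DifferentiableAt ℝ A (incl p)) (hA' : DifferentiableAt ℝ A' (incl p)) {i j k : Fin 3}
    (hki : k ≠ i) (hkj : k ≠ j) :
    fderiv ℝ (wedgeSlotFields B A A' i j) (incl p) (slotVec B p k) =
      (A (incl p) (slotVec B p i) * fderiv ℝ A' (incl p) (slotVec B p k) (slotVec B p j)
        + A' (incl p) (slotVec B p j) * fderiv ℝ A (incl p) (slotVec B p k) (slotVec B p i))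
      - (A (incl p) (slotVec B p j) * fderiv ℝ A' (incl p) (slotVec B p k) (slotVec B p i)
        + A' (incl p) (slotVec B p i) * fderiv ℝ A (incl p) (slotVec B p k) (slotVec B p j)) := by
  have hasFDerivAt_coeff {C : Amb → Amb →L[ℝ] ℝ} (hC : DifferentiableAt ℝ C (incl p))
      (l : Fin 3) : HasFDerivAt (fun q => C q (slotField B l q))
        (fderiv ℝ (fun q => C q (slotField B l q)) (incl p)) (incl p) :=
    (hC.clm_apply ((hB.contDiffAt_slotField p l).differentiableAt (by simp))).hasFDerivAt
  have hasFDerivAt_wedge : HasFDerivAt (wedgeSlotFields B A A' i j) _ (incl p) :=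
    ((hasFDerivAt_coeff hA i).mul (hasFDerivAt_coeff hA' j)).sub
      ((hasFDerivAt_coeff hA j).mul (hasFDerivAt_coeff hA' i))
  rw [hasFDerivAt_wedge.fderiv]
  simp only [sub_apply, add_apply, smul_apply, smul_eq_mul, slotField_incl,
    fderiv_apply_slotField hB hA hki, fderiv_apply_slotField hB hA hkj,
    fderiv_apply_slotField hB hA' hki, fderiv_apply_slotField hB hA' hkj]

/- `A ∧ dA' - dA ∧ A' = -d(A ∧ A')`, and the three fields commute with each other. -/
theorem wedgeSlots_sub_wedgeSlots (hB : IsSVect B) {p : Fin 3 → S3}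
    (hA : DifferentiableAt ℝ A (incl p)) (hA' : DifferentiableAt ℝ A' (incl p)) :
    wedgeSlots B A A' p - wedgeSlots B A' A p =
      fderiv ℝ (wedgeSlotFields B A A' 2 1) (incl p) (slotVec B p 0)
        + fderiv ℝ (wedgeSlotFields B A A' 0 2) (incl p) (slotVec B p 1)
        + fderiv ℝ (wedgeSlotFields B A A' 1 0) (incl p) (slotVec B p 2) := by
  rw [fderiv_wedgeSlotFields_slotVec hB hA hA' (by decide) (by decide),
    fderiv_wedgeSlotFields_slotVec hB hA hA' (by decide) (by decide),
    fderiv_wedgeSlotFields_slotVec hB hA hA' (by decide) (by decide)]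
  simp only [wedgeSlots, wedgeOneTwo, extDerivOne]
  ring

theorem integral_wedgeSlots_comm (hB : IsSVect B) (hT : ∀ i, IsCompact (T i))
    (hBT : ∀ i, IsFlowInvariant B (T i)) (hA : SmoothAlong T A) (hA' : SmoothAlong T A') :
    ∫ p in prodDomain T, wedgeSlots B A A' p ∂vol3 =
      ∫ p in prodDomain T, wedgeSlots B A' A p ∂vol3 := by
  have integrableOn {f : (Fin 3 → S3) → ℝ} (hf : ContinuousOn f (prodDomain T)) :
      IntegrableOn f (prodDomain T) vol3 := hf.integrableOn_compact (isCompact_prodDomain hT)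
  have smooth := smoothAlong_wedgeSlotFields hB hA hA'
  have integrableOn_fderiv (i j k : Fin 3) := integrableOn
    ((smooth i j).continuousOn_fderiv_slotVec hB k)
  have integrableOn_sum : IntegrableOn (fun p =>
      fderiv ℝ (wedgeSlotFields B A A' 2 1) (incl p) (slotVec B p 0)
        + fderiv ℝ (wedgeSlotFields B A A' 0 2) (incl p) (slotVec B p 1)) (prodDomain T) vol3 :=
    (integrableOn_fderiv 2 1 0).add (integrableOn_fderiv 0 2 1)
  rw [← sub_eq_zero, ← integral_sub (integrableOn (continuousOn_wedgeSlots hB hA hA'))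
    (integrableOn (continuousOn_wedgeSlots hB hA' hA)),
    setIntegral_congr_fun (measurableSet_prodDomain hT) fun p hp => wedgeSlots_sub_wedgeSlots hB
      ((hA p hp).differentiableAt (by simp)) ((hA' p hp).differentiableAt (by simp)),
    integral_add integrableOn_sum (integrableOn_fderiv 1 0 2),
    integral_add (integrableOn_fderiv 2 1 0) (integrableOn_fderiv 0 2 1),
    (smooth 2 1).integral_fderiv_slotVec hB hT (hBT 0),
    (smooth 0 2).integral_fderiv_slotVec hB hT (hBT 1),
    (smooth 1 0).integral_fderiv_slotVec hB hT (hBT 2), add_zero, add_zero]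

theorem integral_wedgeSlots_eq_of_extDerivOne_eq (hB : IsSVect B) (hT : ∀ i, IsCompact (T i))
    (hBT : ∀ i, IsFlowInvariant B (T i)) (hA : SmoothAlong T A) (hA' : SmoothAlong T A')
    (h : ∀ p ∈ prodDomain T, ∀ i j, extDerivOne A (incl p) (slotVec B p i) (slotVec B p j) =
      extDerivOne A' (incl p) (slotVec B p i) (slotVec B p j)) :
    ∫ p in prodDomain T, wedgeSlots B A A p ∂vol3 =
      ∫ p in prodDomain T, wedgeSlots B A' A' p ∂vol3 := by
  have replace_extDerivOne (C : Amb → Amb →L[ℝ] ℝ) :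
      ∫ p in prodDomain T, wedgeSlots B C A p ∂vol3 =
        ∫ p in prodDomain T, wedgeSlots B C A' p ∂vol3 :=
    setIntegral_congr_fun (measurableSet_prodDomain hT) fun p hp => by
      simp only [wedgeSlots, wedgeOneTwo, h p hp]
  calc ∫ p in prodDomain T, wedgeSlots B A A p ∂vol3
      = ∫ p in prodDomain T, wedgeSlots B A A' p ∂vol3 := replace_extDerivOne A
    _ = ∫ p in prodDomain T, wedgeSlots B A' A p ∂vol3 :=
        integral_wedgeSlots_comm hB hT hBT hA hA'
    _ = ∫ p in prodDomain T, wedgeSlots B A' A' p ∂vol3 := replace_extDerivOne A'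

end OneForms

section ParametricIntegral

theorem hasDerivAt_setIntegral_of_continuousOn {X E : Type*} [TopologicalSpace X]
    [MeasurableSpace X] [OpensMeasurableSpace X] [NormedAddCommGroup E] [NormedSpace ℝ E]
    {μ : Measure X} [IsFiniteMeasureOnCompacts μ] {K : Set X} (hK : IsCompact K)
    (measurableSet : MeasurableSet K) {f f' : ℝ → X → E} (hf : ∀ t, ContinuousOn (f t) K)
    (hf' : ContinuousOn (Function.uncurry f') (Set.univ ×ˢ K))
    (hasDerivAt : ∀ t, ∀ x ∈ K, HasDerivAt (fun s => f s x) (f' t x) t) (t : ℝ) :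
    HasDerivAt (fun s => ∫ x in K, f s x ∂μ) (∫ x in K, f' t x ∂μ) t := by
  obtain ⟨C, bound⟩ := ((isCompact_closedBall t 1).prod hK).exists_bound_of_continuousOn
    (hf'.mono (Set.prod_mono_left (Set.subset_univ _)))
  have continuousOn_f' : ContinuousOn (f' t) K :=
    hf'.comp (f := fun x => (t, x)) (by fun_prop) fun x hx => ⟨trivial, hx⟩
  exact (hasDerivAt_integral_of_dominated_loc_of_deriv_le (bound := fun _ => C)
    (Metric.closedBall_mem_nhds t one_pos)
    (Eventually.of_forall fun s => (hf s).aestronglyMeasurable_of_isCompact hK measurableSet)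
    ((hf t).integrableOn_compact' hK measurableSet)
    (continuousOn_f'.aestronglyMeasurable_of_isCompact hK measurableSet)
    (ae_restrict_of_forall_mem measurableSet fun x hx s hs => bound (s, x) ⟨hs, hx⟩)
    (integrableOn_const hK.measure_ne_top)
    (ae_restrict_of_forall_mem measurableSet fun x hx s _ => hasDerivAt s x hx)).2

variable {Z E : Type*} [NormedAddCommGroup Z] [NormedSpace ℝ Z] [NormedAddCommGroup E]
  [NormedSpace ℝ E] {f : ℝ × Z → E} {V : Set Z}

/-- The partial derivative of `f` in the direction of the second factor. -/
def fderivSnd (f : ℝ × Z → E) (y : ℝ × Z) : Z →L[ℝ] E :=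
  (fderiv ℝ f y).comp (ContinuousLinearMap.inr ℝ ℝ Z)

theorem hasFDerivAt_comp_prodMk_fderivSnd {t : ℝ} {z : Z} (hf : DifferentiableAt ℝ f (t, z)) :
    HasFDerivAt (fun q => f (t, q)) (fderivSnd f (t, z)) z :=
  hf.hasFDerivAt.comp z (hasFDerivAt_prodMk_right t z)

theorem contDiffAt_fderivSnd {y : ℝ × Z} (hf : ContDiffAt ℝ ∞ f y) :
    ContDiffAt ℝ ∞ (fderivSnd f) y :=
  (hf.fderiv_right (m := ∞) (by simp)).clm_comp contDiffAt_const

theorem contDiffAt_of_contDiffOn_univ_prod (hV : IsOpen V)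
    (hf : ContDiffOn ℝ ∞ f (Set.univ ×ˢ V)) (t : ℝ) {z : Z} (hz : z ∈ V) :
    ContDiffAt ℝ ∞ f (t, z) :=
  hf.contDiffAt ((isOpen_univ.prod hV).mem_nhds ⟨trivial, hz⟩)

theorem contDiffOn_fderivSnd (hV : IsOpen V) (hf : ContDiffOn ℝ ∞ f (Set.univ ×ˢ V)) :
    ContDiffOn ℝ ∞ (fderivSnd f) (Set.univ ×ˢ V) := fun y hy =>
  (contDiffAt_fderivSnd
    (contDiffAt_of_contDiffOn_univ_prod hV hf y.1 hy.2)).contDiffWithinAt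

theorem continuous_comp_prodMk_of_contDiffOn (hf : ContDiffOn ℝ ∞ f (Set.univ ×ˢ V)) {z : Z}
    (hz : z ∈ V) : Continuous fun t => f (t, z) :=
  hf.continuousOn.comp_continuous (by fun_prop) fun _ => ⟨trivial, hz⟩

theorem hasFDerivAt_intervalIntegral_of_contDiffOn [ProperSpace Z] (hV : IsOpen V)
    (hf : ContDiffOn ℝ ∞ f (Set.univ ×ˢ V)) {z : Z} (hz : z ∈ V) (a b : ℝ) :
    HasFDerivAt (fun q => ∫ s in a..b, f (s, q)) (∫ s in a..b, fderivSnd f (s, z)) z := by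
  have contDiffOn_deriv := contDiffOn_fderivSnd hV hf
  obtain ⟨ε, ε_pos, ball_subset⟩ := Metric.nhds_basis_closedBall.mem_iff.1 (hV.mem_nhds hz)
  obtain ⟨C, bound⟩ := (isCompact_uIcc (a := a) (b := b)).prod (isCompact_closedBall z ε)
    |>.exists_bound_of_continuousOn
      (contDiffOn_deriv.continuousOn.mono (Set.prod_mono (Set.subset_univ _) ball_subset))
  exact intervalIntegral.hasFDerivAt_integral_of_dominated_of_fderiv_le (bound := fun _ => C)
    (F := fun q s => f (s, q)) (F' := fun q s => fderivSnd f (s, q))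
    (Metric.closedBall_mem_nhds z ε_pos)
    ((hV.eventually_mem hz).mono fun q hq =>
      (continuous_comp_prodMk_of_contDiffOn hf hq).aestronglyMeasurable)
    ((continuous_comp_prodMk_of_contDiffOn hf hz).intervalIntegrable _ _)
    (continuous_comp_prodMk_of_contDiffOn contDiffOn_deriv hz).aestronglyMeasurable
    (Eventually.of_forall fun s hs q hq => bound (s, q) ⟨Set.uIoc_subset_uIcc hs, hq⟩)
    intervalIntegrable_const
    (Eventually.of_forall fun s _ q hq => hasFDerivAt_comp_prodMk_fderivSnd
      ((contDiffAt_of_contDiffOn_univ_prod hV hf s (ball_subset hq)).differentiableAt (by simp)))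

universe u

theorem contDiffOn_intervalIntegral {Z E : Type u} [NormedAddCommGroup Z] [NormedSpace ℝ Z]
    [ProperSpace Z] [NormedAddCommGroup E] [NormedSpace ℝ E] {f : ℝ × Z → E} {V : Set Z}
    (hV : IsOpen V) (hf : ContDiffOn ℝ ∞ f (Set.univ ×ˢ V)) (a b : ℝ) :
    ContDiffOn ℝ ∞ (fun z => ∫ s in a..b, f (s, z)) V := by
  rw [contDiffOn_infty]
  intro n
  induction n generalizing E with
  | zero =>
    rw [Nat.cast_zero, contDiffOn_zero]
    exact fun z hz =>
      (hasFDerivAt_intervalIntegral_of_contDiffOn hV hf hz a b).continuousAt.continuousWithinAt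
  | succ n ih =>
    have hasFDerivAt := fun z (hz : z ∈ V) =>
      hasFDerivAt_intervalIntegral_of_contDiffOn hV hf hz a b
    rw [Nat.cast_succ, contDiffOn_succ_iff_fderiv_of_isOpen hV]
    refine ⟨fun z hz => (hasFDerivAt z hz).differentiableAt.differentiableWithinAt, by simp, ?_⟩
    exact (ih (contDiffOn_fderivSnd hV hf)).congr fun z hz => (hasFDerivAt z hz).fderiv

end ParametricIntegral

section AreaForm

set_option maxSynthPendingDepth 3

/-- The determinant of three vectors of `ℝ³`, as a continuous trilinear map. -/
def tripleDet : EuclideanSpace ℝ (Fin 3) →L[ℝ] EuclideanSpace ℝ (Fin 3) →L[ℝ]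
    EuclideanSpace ℝ (Fin 3) →L[ℝ] ℝ :=
  let π : Fin 3 → EuclideanSpace ℝ (Fin 3) →L[ℝ] ℝ := fun i => EuclideanSpace.proj i
  (π 0).smulRight ((π 1).smulRight (π 2) - (π 2).smulRight (π 1))
  + (π 1).smulRight ((π 2).smulRight (π 0) - (π 0).smulRight (π 2))
  + (π 2).smulRight ((π 0).smulRight (π 1) - (π 1).smulRight (π 0))

theorem tripleDet_apply (a b c : EuclideanSpace ℝ (Fin 3)) :
    tripleDet a b c = a 0 * (b 1 * c 2 - b 2 * c 1) + a 1 * (b 2 * c 0 - b 0 * c 2)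
      + a 2 * (b 0 * c 1 - b 1 * c 0) := by
  simp [tripleDet]

theorem areaForm_apply (a b c : EuclideanSpace ℝ (Fin 3)) :
    areaForm a ![b, c] = tripleDet a b c := by
  calc areaForm a ![b, c] = (EuclideanSpace.basisFun (Fin 3) ℝ).toBasis.det ![a, b, c] := rfl
    _ = tripleDet a b c := by
      rw [tripleDet_apply, Module.Basis.det_apply, Matrix.det_fin_three]
      simp only [Module.Basis.toMatrix_apply, OrthonormalBasis.coe_toBasis_repr_apply,
        EuclideanSpace.basisFun_repr, Matrix.cons_val]
      ring

/- The Plücker relation: a two-form on a surface wedges to zero with its contractions. -/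
theorem wedgeOneTwo_tripleDet (n a : EuclideanSpace ℝ (Fin 3))
    (v : Fin 3 → EuclideanSpace ℝ (Fin 3)) :
    wedgeOneTwo (tripleDet n a) (fun b c => tripleDet n b c) v = 0 := by
  simp only [wedgeOneTwo, tripleDet_apply]
  ring

theorem tripleDet_eq_zero_of_inner_eq_zero {n a b c : EuclideanSpace ℝ (Fin 3)} (hn : n ≠ 0)
    (ha : inner ℝ n a = 0) (hb : inner ℝ n b = 0) (hc : inner ℝ n c = 0) :
    tripleDet a b c = 0 := by
  simp only [PiLp.inner_apply, Fin.sum_univ_three, RCLike.inner_apply, conj_trivial] at ha hb hc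
  have cramer (i : Fin 3) : tripleDet a b c * n i = 0 := by
    rw [tripleDet_apply]
    fin_cases i <;> simp only [Fin.zero_eta, Fin.mk_one, Fin.reduceFinMk]
    · linear_combination (b 1 * c 2 - b 2 * c 1) * ha + (c 1 * a 2 - c 2 * a 1) * hb
        + (a 1 * b 2 - a 2 * b 1) * hc
    · linear_combination (b 2 * c 0 - b 0 * c 2) * ha + (c 2 * a 0 - c 0 * a 2) * hb
        + (a 2 * b 0 - a 0 * b 2) * hc
    · linear_combination (b 0 * c 1 - b 1 * c 0) * ha + (c 0 * a 1 - c 1 * a 0) * hb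
        + (a 0 * b 1 - a 1 * b 0) * hc
  by_contra det_ne_zero
  exact hn (PiLp.ext fun i => (mul_eq_zero.1 (cramer i)).resolve_left det_ne_zero)

variable {Y : Type*} [NormedAddCommGroup Y] [NormedSpace ℝ Y]
  {F : Y → EuclideanSpace ℝ (Fin 3)} {y : Y}

/-- The pull-back `F^* ν` of the area form of `S²`, evaluated on the vectors `u`, `v` at `y`. -/
def pullArea (F : Y → EuclideanSpace ℝ (Fin 3)) (y u v : Y) : ℝ :=
  tripleDet (F y) (fderiv ℝ F y u) (fderiv ℝ F y v)

theorem contDiffAt_pullArea (hF : ContDiffAt ℝ ∞ F y) (u v : Y) :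
    ContDiffAt ℝ ∞ (fun z => pullArea F z u v) y :=
  have contDiffAt_fderiv := hF.fderiv_right (m := ∞) (by simp)
  ((tripleDet.contDiff.contDiffAt.comp y hF).clm_apply
    (contDiffAt_fderiv.clm_apply contDiffAt_const)).clm_apply
    (contDiffAt_fderiv.clm_apply contDiffAt_const)

theorem fderiv_pullArea (hF : ContDiffAt ℝ ∞ F y) (u v w : Y) :
    fderiv ℝ (fun z => pullArea F z v w) y u =
      tripleDet (fderiv ℝ F y u) (fderiv ℝ F y v) (fderiv ℝ F y w)
      + tripleDet (F y) (fderiv ℝ (fderiv ℝ F) y u v) (fderiv ℝ F y w)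
      + tripleDet (F y) (fderiv ℝ F y v) (fderiv ℝ (fderiv ℝ F) y u w) := by
  have hasFDerivAt_fderiv_apply (v : Y) := ((hF.fderiv_right (m := ∞) (by simp)).differentiableAt
    (by simp)).hasFDerivAt.clm_apply (hasFDerivAt_const v y)
  have hasFDerivAt_pullArea : HasFDerivAt (fun z => pullArea F z v w) _ y :=
    ((tripleDet.hasFDerivAt.comp y (hF.differentiableAt (by simp)).hasFDerivAt).clm_apply
      (hasFDerivAt_fderiv_apply v)).clm_apply (hasFDerivAt_fderiv_apply w)
  rw [hasFDerivAt_pullArea.fderiv]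
  simp only [Function.comp_apply, ContinuousLinearMap.comp_zero, zero_add, add_apply,
    ContinuousLinearMap.flip_add, ContinuousLinearMap.comp_apply, ContinuousLinearMap.flip_apply]
  ring

theorem inner_fderiv_eq_zero_of_norm_eq_one {E : Type*} [NormedAddCommGroup E]
    [InnerProductSpace ℝ E] {F : Y → E} (hF : DifferentiableAt ℝ F y)
    (norm_eq_one : ∀ᶠ z in 𝓝 y, ‖F z‖ = 1) (u : Y) : inner ℝ (F y) (fderiv ℝ F y u) = 0 := by
  have norm_sq_eq_one : (fun z => ‖F z‖ ^ 2) =ᶠ[𝓝 y] fun _ => 1 :=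
    norm_eq_one.mono fun z hz => by simp [hz]
  have fderiv_eq_zero :=
    hF.hasFDerivAt.norm_sq.unique ((hasFDerivAt_const 1 y).congr_of_eventuallyEq norm_sq_eq_one)
  simpa using congrArg (fun L : Y →L[ℝ] ℝ => L u) fderiv_eq_zero

/- `d(F^* ν)` is the pull-back of a three-form under a map of rank at most two. -/
theorem pullArea_closed (hF : ContDiffAt ℝ ∞ F y) (norm_eq_one : ∀ᶠ z in 𝓝 y, ‖F z‖ = 1)
    (u v w : Y) :
    fderiv ℝ (fun z => pullArea F z v w) y u - fderiv ℝ (fun z => pullArea F z u w) y v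
      + fderiv ℝ (fun z => pullArea F z u v) y w = 0 := by
  have second_symm (a b : Y) :
      fderiv ℝ (fderiv ℝ F) y a b = fderiv ℝ (fderiv ℝ F) y b a :=
    (hF.isSymmSndFDerivAt (by simpa using ENat.LEInfty.out)).eq a b
  have tangent := inner_fderiv_eq_zero_of_norm_eq_one (hF.differentiableAt (by simp)) norm_eq_one
  have ne_zero : F y ≠ 0 := norm_ne_zero_iff.1 (by simp [norm_eq_one.self_of_nhds])
  have det_eq_zero :=
    tripleDet_eq_zero_of_inner_eq_zero ne_zero (tangent u) (tangent v) (tangent w)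
  rw [fderiv_pullArea hF, fderiv_pullArea hF, fderiv_pullArea hF, second_symm v u,
    second_symm w u, second_symm w v]
  simp only [tripleDet_apply] at det_eq_zero ⊢
  linear_combination 3 * det_eq_zero

theorem pullArea_comp {X : Type*} [NormedAddCommGroup X] [NormedSpace ℝ X] {φ : X → Y} {x : X}
    (hF : DifferentiableAt ℝ F (φ x)) (hφ : DifferentiableAt ℝ φ x) (u v : X) :
    pullArea (fun z => F (φ z)) x u v = pullArea F (φ x) (fderiv ℝ φ x u) (fderiv ℝ φ x v) := by
  simp only [pullArea, fderiv_fun_comp x hF hφ, ContinuousLinearMap.comp_apply]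

end AreaForm

section SphereHomotopy

set_option maxSynthPendingDepth 3

variable {Z : Type*} [NormedAddCommGroup Z] [NormedSpace ℝ Z]
  {F : ℝ × Z → EuclideanSpace ℝ (Fin 3)} {W : Set Z} {t : ℝ} {z : Z}

/-- `F` is a smooth homotopy, with time running through `ℝ`, of maps from the open set `W` to the
unit sphere of `ℝ³`. -/
structure IsSphereHomotopy (F : ℝ × Z → EuclideanSpace ℝ (Fin 3)) (W : Set Z) : Prop where
  isOpen : IsOpen W
  contDiffOn : ContDiffOn ℝ ∞ F (Set.univ ×ˢ W)
  norm_eq_one : ∀ y ∈ Set.univ ×ˢ W, ‖F y‖ = 1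

/-- The one-form `ι_{∂/∂t} F^* ν` on the slice of `ℝ × Z` through `y`. -/
def etaForm (F : ℝ × Z → EuclideanSpace ℝ (Fin 3)) (y : ℝ × Z) : Z →L[ℝ] ℝ :=
  (tripleDet (F y) (fderiv ℝ F y (1, 0))).comp (fderivSnd F y)

/-- The primitive in time of `etaForm F`. -/
def kappaForm (F : ℝ × Z → EuclideanSpace ℝ (Fin 3)) (t : ℝ) (z : Z) : Z →L[ℝ] ℝ :=
  ∫ s in (0 : ℝ)..t, etaForm F (s, z)

theorem kappaForm_zero : kappaForm F 0 = 0 :=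
  funext fun _ => intervalIntegral.integral_same

theorem pullArea_slice (hF : DifferentiableAt ℝ F (t, z)) (u v : Z) :
    pullArea (fun q => F (t, q)) z u v = pullArea F (t, z) (0, u) (0, v) := by
  simp only [pullArea, (hasFDerivAt_comp_prodMk_fderivSnd hF).fderiv, fderivSnd,
    ContinuousLinearMap.comp_apply, ContinuousLinearMap.inr_apply]

theorem contDiffAt_etaForm {y : ℝ × Z} (hF : ContDiffAt ℝ ∞ F y) :
    ContDiffAt ℝ ∞ (etaForm F) y :=
  ((tripleDet.contDiff.contDiffAt.comp y hF).clm_apply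
    ((hF.fderiv_right (m := ∞) (by simp)).clm_apply contDiffAt_const)).clm_comp
    (contDiffAt_fderivSnd hF)

theorem fderivSnd_etaForm (hF : ContDiffAt ℝ ∞ F (t, z)) (u v : Z) :
    fderivSnd (etaForm F) (t, z) u v =
      fderiv ℝ (fun y => pullArea F y (1, 0) (0, v)) (t, z) (0, u) := by
  have hasFDerivAt_etaForm_apply : HasFDerivAt (fun y => etaForm F y v) _ (t, z) :=
    ((contDiffAt_etaForm hF).differentiableAt (by simp)).hasFDerivAt.clm_apply
      (hasFDerivAt_const v (t, z))
  have etaForm_apply : (fun y => pullArea F y (1, 0) (0, v)) = fun y => etaForm F y v := rfl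
  rw [etaForm_apply, hasFDerivAt_etaForm_apply.fderiv]
  simp [fderivSnd]

theorem extDerivOne_etaForm (hF : ContDiffAt ℝ ∞ F (t, z)) (u v : Z) :
    extDerivOne (fun q => etaForm F (t, q)) z u v =
      fderivSnd (etaForm F) (t, z) u v - fderivSnd (etaForm F) (t, z) v u := by
  rw [extDerivOne, (hasFDerivAt_comp_prodMk_fderivSnd
    ((contDiffAt_etaForm hF).differentiableAt (by simp))).fderiv]

namespace IsSphereHomotopy

variable (hF : IsSphereHomotopy F W)

include hF

theorem contDiffAt (t : ℝ) (hz : z ∈ W) : ContDiffAt ℝ ∞ F (t, z) :=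
  contDiffAt_of_contDiffOn_univ_prod hF.isOpen hF.contDiffOn t hz

theorem contDiffOn_etaForm : ContDiffOn ℝ ∞ (etaForm F) (Set.univ ×ˢ W) := fun y hy =>
  (contDiffAt_etaForm (hF.contDiffAt y.1 hy.2)).contDiffWithinAt

theorem hasDerivAt_pullArea (hz : z ∈ W) (t : ℝ) (u v : Z) :
    HasDerivAt (fun s => pullArea (fun q => F (s, q)) z u v)
      (extDerivOne (fun q => etaForm F (t, q)) z u v) t := by
  have contDiffAt_F := hF.contDiffAt t hz
  have slice_eq : (fun s => pullArea (fun q => F (s, q)) z u v) =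
      fun s => pullArea F (s, z) (0, u) (0, v) :=
    funext fun s => pullArea_slice ((hF.contDiffAt s hz).differentiableAt (by simp)) u v
  have closed := pullArea_closed contDiffAt_F (Filter.eventually_of_mem
    ((isOpen_univ.prod hF.isOpen).mem_nhds ⟨trivial, hz⟩) hF.norm_eq_one) (1, 0) (0, u) (0, v)
  have hasDerivAt_slice := ((contDiffAt_pullArea contDiffAt_F (0, u) (0, v)).differentiableAt
    (by simp)).hasFDerivAt.comp_hasDerivAt t ((hasDerivAt_id t).prodMk (hasDerivAt_const t z))
  rw [slice_eq, extDerivOne_etaForm contDiffAt_F, fderivSnd_etaForm contDiffAt_F,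
    fderivSnd_etaForm contDiffAt_F]
  exact hasDerivAt_slice.congr_deriv (by linear_combination closed)

theorem hasDerivAt_kappaForm (hz : z ∈ W) (t : ℝ) :
    HasDerivAt (fun s => kappaForm F s z) (etaForm F (t, z)) t :=
  ((continuous_comp_prodMk_of_contDiffOn hF.contDiffOn_etaForm hz).integral_hasStrictDerivAt
    0 t).hasDerivAt

variable [ProperSpace Z]

theorem contDiffOn_kappaForm :
    ContDiffOn ℝ ∞ (fun y : ℝ × Z => kappaForm F y.1 y.2) (Set.univ ×ˢ W) := by
  have contDiffOn_rescaled : ContDiffOn ℝ ∞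
      (fun x : ℝ × (ℝ × Z) => etaForm F (x.2.1 * x.1, x.2.2)) (Set.univ ×ˢ (Set.univ ×ˢ W)) :=
    hF.contDiffOn_etaForm.comp (f := fun x : ℝ × (ℝ × Z) => (x.2.1 * x.1, x.2.2)) (by fun_prop)
      fun x hx => ⟨trivial, hx.2.2⟩
  have kappaForm_eq (y : ℝ × Z) :
      kappaForm F y.1 y.2 = y.1 • ∫ s in (0 : ℝ)..1, etaForm F (y.1 * s, y.2) := by
    rw [intervalIntegral.smul_integral_comp_mul_left (fun s => etaForm F (s, y.2)), kappaForm,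
      mul_zero, mul_one]
  simp only [kappaForm_eq]
  exact contDiffOn_fst.smul
    (contDiffOn_intervalIntegral (isOpen_univ.prod hF.isOpen) contDiffOn_rescaled 0 1)

theorem contDiffAt_kappaForm (t : ℝ) (hz : z ∈ W) : ContDiffAt ℝ ∞ (kappaForm F t) z :=
  (contDiffAt_of_contDiffOn_univ_prod hF.isOpen hF.contDiffOn_kappaForm t hz).comp
    (f := fun q => (t, q)) z (contDiffAt_const.prodMk contDiffAt_id)

theorem fderiv_kappaForm (hz : z ∈ W) (t : ℝ) (u v : Z) :
    fderiv ℝ (kappaForm F t) z u v = ∫ s in (0 : ℝ)..t, fderivSnd (etaForm F) (s, z) u v := by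
  have continuous_fderivSnd : Continuous fun s => fderivSnd (etaForm F) (s, z) :=
    continuous_comp_prodMk_of_contDiffOn
      (contDiffOn_fderivSnd hF.isOpen hF.contDiffOn_etaForm) hz
  have hasFDerivAt_kappaForm : HasFDerivAt (kappaForm F t) _ z :=
    hasFDerivAt_intervalIntegral_of_contDiffOn hF.isOpen hF.contDiffOn_etaForm hz 0 t
  rw [hasFDerivAt_kappaForm.fderiv,
    ContinuousLinearMap.intervalIntegral_apply (continuous_fderivSnd.intervalIntegrable _ _),
    ContinuousLinearMap.intervalIntegral_apply
      ((continuous_fderivSnd.clm_apply continuous_const).intervalIntegrable _ _)]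

theorem extDerivOne_kappaForm (hz : z ∈ W) (t : ℝ) (u v : Z) :
    extDerivOne (kappaForm F t) z u v =
      pullArea (fun q => F (t, q)) z u v - pullArea (fun q => F (0, q)) z u v := by
  have continuous_apply (u v : Z) : Continuous fun s => fderivSnd (etaForm F) (s, z) u v :=
    ((continuous_comp_prodMk_of_contDiffOn (contDiffOn_fderivSnd hF.isOpen
      hF.contDiffOn_etaForm) hz).clm_apply continuous_const).clm_apply continuous_const
  rw [extDerivOne, hF.fderiv_kappaForm hz, hF.fderiv_kappaForm hz,
    ← intervalIntegral.integral_sub ((continuous_apply u v).intervalIntegrable _ _)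
      ((continuous_apply v u).intervalIntegrable _ _)]
  refine intervalIntegral.integral_eq_sub_of_hasDerivAt
    (f := fun s => pullArea (fun q => F (s, q)) z u v) (fun s _ => ?_)
    (((continuous_apply u v).sub (continuous_apply v u)).intervalIntegrable _ _)
  rw [← extDerivOne_etaForm (hF.contDiffAt s hz)]
  exact hF.hasDerivAt_pullArea hz s u v

end IsSphereHomotopy

end SphereHomotopy

section HelicityHomotopy

set_option maxSynthPendingDepth 3

theorem hasDerivAt_wedgeOneTwo {V : Type*} {a : ℝ → V → ℝ} {b : ℝ → V → V → ℝ} {a' : V → ℝ}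
    {b' : V → V → ℝ} {v : Fin 3 → V} {t : ℝ}
    (ha : ∀ i, HasDerivAt (fun s => a s (v i)) (a' (v i)) t)
    (hb : ∀ i j, HasDerivAt (fun s => b s (v i) (v j)) (b' (v i) (v j)) t) :
    HasDerivAt (fun s => wedgeOneTwo (a s) (b s) v)
      (wedgeOneTwo a' (b t) v + wedgeOneTwo (a t) b' v) t := by
  refine ((((ha 0).mul (hb 1 2)).sub ((ha 1).mul (hb 0 2))).add
    ((ha 2).mul (hb 0 1))).congr_deriv ?_
  simp only [wedgeOneTwo]
  ring

theorem extDerivOne_add {E : Type*} [NormedAddCommGroup E] [NormedSpace ℝ E]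
    {A A' : E → E →L[ℝ] ℝ} {x : E} (hA : DifferentiableAt ℝ A x) (hA' : DifferentiableAt ℝ A' x)
    (u v : E) : extDerivOne (A + A') x u v = extDerivOne A x u v + extDerivOne A' x u v := by
  simp only [extDerivOne, fderiv_add hA hA', add_apply]
  ring

/-- If `A` is a primitive of `F₀^* ν`, then `evolvedForm A F t` is a primitive of `F_t^* ν`. -/
def evolvedForm {Z : Type*} [NormedAddCommGroup Z] [NormedSpace ℝ Z] (A : Z → Z →L[ℝ] ℝ)
    (F : ℝ × Z → EuclideanSpace ℝ (Fin 3)) (t : ℝ) : Z → Z →L[ℝ] ℝ :=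
  A + kappaForm F t

theorem evolvedForm_zero {Z : Type*} [NormedAddCommGroup Z] [NormedSpace ℝ Z]
    (A : Z → Z →L[ℝ] ℝ) (F : ℝ × Z → EuclideanSpace ℝ (Fin 3)) : evolvedForm A F 0 = A := by
  rw [evolvedForm, kappaForm_zero, add_zero]

namespace IsSphereHomotopy

variable {B : VField} {T : Fin 3 → Set S3} {A : Amb → Amb →L[ℝ] ℝ}
  {F : ℝ × Amb → EuclideanSpace ℝ (Fin 3)} {W : Set Amb} (hF : IsSphereHomotopy F W)
  (hTW : ∀ p ∈ prodDomain T, incl p ∈ W)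

include hF

theorem extDerivOne_evolvedForm {q : Amb} (hq : q ∈ W) (hA : DifferentiableAt ℝ A q) {u v : Amb}
    (hdA : extDerivOne A q u v = pullArea (fun q => F (0, q)) q u v) (t : ℝ) :
    extDerivOne (evolvedForm A F t) q u v = pullArea (fun q => F (t, q)) q u v := by
  rw [evolvedForm, extDerivOne_add hA ((hF.contDiffAt_kappaForm t hq).differentiableAt (by simp)),
    hF.extDerivOne_kappaForm hq, hdA, add_sub_cancel]

theorem wedgeOneTwo_etaForm_pullArea {q : Amb} (hq : q ∈ W) (t : ℝ) (v : Fin 3 → Amb) :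
    wedgeOneTwo (etaForm F (t, q)) (pullArea (fun q => F (t, q)) q) v = 0 := by
  have slice := fun u w => pullArea_slice ((hF.contDiffAt t hq).differentiableAt (by simp)) u w
  rw [funext₂ slice]
  exact wedgeOneTwo_tripleDet (F (t, q)) (fderiv ℝ F (t, q) (1, 0))
    fun i => fderiv ℝ F (t, q) (0, v i)

theorem hasDerivAt_wedgeOneTwo_evolvedForm {q : Amb} (hq : q ∈ W) (t : ℝ) (v : Fin 3 → Amb) :
    HasDerivAt (fun s => wedgeOneTwo (evolvedForm A F s q) (pullArea (fun q => F (s, q)) q) v)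
      (wedgeOneTwo (evolvedForm A F t q) (extDerivOne (fun q => etaForm F (t, q)) q) v) t := by
  have hasDerivAt_evolvedForm (i : Fin 3) :
      HasDerivAt (fun s => evolvedForm A F s q (v i)) (etaForm F (t, q) (v i)) t := by
    simpa [evolvedForm] using ((hF.hasDerivAt_kappaForm hq t).const_add (A q)).clm_apply
      (hasDerivAt_const t (v i))
  refine (hasDerivAt_wedgeOneTwo hasDerivAt_evolvedForm
    fun i j => hF.hasDerivAt_pullArea hq t (v i) (v j)).congr_deriv ?_
  rw [hF.wedgeOneTwo_etaForm_pullArea hq, zero_add]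

include hTW

theorem smoothAlong_evolvedForm (hA : SmoothAlong T A) (t : ℝ) :
    SmoothAlong T (evolvedForm A F t) := fun p hp =>
  (hA p hp).add (hF.contDiffAt_kappaForm t (hTW p hp))

theorem smoothAlong_etaForm (t : ℝ) : SmoothAlong T fun q => etaForm F (t, q) := fun p hp =>
  (contDiffAt_etaForm (hF.contDiffAt t (hTW p hp))).comp (incl p)
    (contDiffAt_const.prodMk contDiffAt_id)

theorem continuousOn_wedgeSlots_evolvedForm_etaForm (hB : IsSVect B) (hA : SmoothAlong T A) :
    ContinuousOn (fun x : ℝ × (Fin 3 → S3) =>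
      wedgeSlots B (evolvedForm A F x.1) (fun q => etaForm F (x.1, q)) x.2)
      (Set.univ ×ˢ prodDomain T) := by
  have continuousOn_comp_incl {E : Type} [TopologicalSpace E] {f : ℝ × Amb → E}
      (hf : ContinuousOn f (Set.univ ×ˢ W)) : ContinuousOn
        (fun x : ℝ × (Fin 3 → S3) => f (x.1, incl x.2)) (Set.univ ×ˢ prodDomain T) :=
    hf.comp (f := fun x : ℝ × (Fin 3 → S3) => (x.1, incl x.2))
      (continuous_fst.prodMk (continuous_incl.comp continuous_snd)).continuousOn
      fun x hx => ⟨trivial, hTW x.2 hx.2⟩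
  have continuousOn_slotVec (i : Fin 3) : ContinuousOn
      (fun x : ℝ × (Fin 3 → S3) => slotVec B x.2 i) (Set.univ ×ˢ prodDomain T) :=
    ((hB.continuous_slotVec i).comp continuous_snd).continuousOn
  have continuousOn_evolvedForm : ContinuousOn
      (fun x : ℝ × (Fin 3 → S3) => evolvedForm A F x.1 (incl x.2)) (Set.univ ×ˢ prodDomain T) :=
    (hA.continuousOn.comp continuousOn_snd fun x hx => hx.2).add
      (continuousOn_comp_incl hF.contDiffOn_kappaForm.continuousOn)
  have continuousOn_fderivSnd :=
    continuousOn_comp_incl (contDiffOn_fderivSnd hF.isOpen hF.contDiffOn_etaForm).continuousOn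
  refine continuousOn_wedgeOneTwo
    (fun i => continuousOn_evolvedForm.clm_apply (continuousOn_slotVec i)) fun i j =>
    (((continuousOn_fderivSnd.clm_apply (continuousOn_slotVec i)).clm_apply
      (continuousOn_slotVec j)).sub ((continuousOn_fderivSnd.clm_apply
      (continuousOn_slotVec j)).clm_apply (continuousOn_slotVec i))).congr fun x hx => ?_
  exact extDerivOne_etaForm (hF.contDiffAt x.1 (hTW x.2 hx.2)) _ _

theorem integral_wedgeSlots_evolvedForm (hB : IsSVect B) (hT : ∀ i, IsCompact (T i))
    (hBT : ∀ i, IsFlowInvariant B (T i)) (hA : SmoothAlong T A)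
    (hdA : ∀ p ∈ prodDomain T, ∀ i j, extDerivOne A (incl p) (slotVec B p i) (slotVec B p j) =
      pullArea (fun q => F (0, q)) (incl p) (slotVec B p i) (slotVec B p j)) (t : ℝ) :
    ∫ p in prodDomain T, wedgeSlots B (evolvedForm A F t) (evolvedForm A F t) p ∂vol3 =
      ∫ p in prodDomain T, wedgeSlots B A A p ∂vol3 := by
  have smooth_evolved := hF.smoothAlong_evolvedForm hTW hA
  have wedgeSlots_evolved (C : Amb → Amb →L[ℝ] ℝ) (s : ℝ) (p) (hp : p ∈ prodDomain T) :
      wedgeSlots B C (evolvedForm A F s) p =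
        wedgeOneTwo (C (incl p)) (pullArea (fun q => F (s, q)) (incl p)) (slotVec B p) := by
    have extDerivOne_eq (i j : Fin 3) := hF.extDerivOne_evolvedForm (hTW p hp)
      ((hA p hp).differentiableAt (by simp)) (hdA p hp i j) s
    simp only [wedgeSlots, wedgeOneTwo, extDerivOne_eq]
  have hasDerivAt_wedgeSlots (s : ℝ) (p) (hp : p ∈ prodDomain T) :
      HasDerivAt (fun s => wedgeSlots B (evolvedForm A F s) (evolvedForm A F s) p)
        (wedgeSlots B (evolvedForm A F s) (fun q => etaForm F (s, q)) p) s := by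
    simp only [fun s => wedgeSlots_evolved (evolvedForm A F s) s p hp]
    exact hF.hasDerivAt_wedgeOneTwo_evolvedForm (hTW p hp) s (slotVec B p)
  have integral_deriv_eq_zero (s : ℝ) : ∫ p in prodDomain T,
      wedgeSlots B (evolvedForm A F s) (fun q => etaForm F (s, q)) p ∂vol3 = 0 := by
    rw [integral_wedgeSlots_comm hB hT hBT (smooth_evolved s) (hF.smoothAlong_etaForm hTW s)]
    exact setIntegral_eq_zero_of_forall_eq_zero fun p hp =>
      (wedgeSlots_evolved _ s p hp).trans (hF.wedgeOneTwo_etaForm_pullArea (hTW p hp) s _)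
  have hasDerivAt_integral := hasDerivAt_setIntegral_of_continuousOn (μ := vol3)
    (f := fun s => wedgeSlots B (evolvedForm A F s) (evolvedForm A F s))
    (f' := fun s => wedgeSlots B (evolvedForm A F s) fun q => etaForm F (s, q))
    (isCompact_prodDomain hT) (measurableSet_prodDomain hT)
    (fun s => continuousOn_wedgeSlots hB (smooth_evolved s) (smooth_evolved s))
    (hF.continuousOn_wedgeSlots_evolvedForm_etaForm hTW hB hA) hasDerivAt_wedgeSlots
  have is_const := is_const_of_deriv_eq_zero (fun s => (hasDerivAt_integral s).differentiableAt)
    (fun s => (hasDerivAt_integral s).deriv.trans (integral_deriv_eq_zero s)) t 0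
  simpa only [evolvedForm_zero] using is_const

end IsSphereHomotopy

end HelicityHomotopy

section ConfMap

set_option maxSynthPendingDepth 3

theorem contDiffAt_stereo {q : ℍ[ℝ]} (re_ne_one : q.re ≠ 1) : ContDiffAt ℝ ∞ stereo q := by
  have contDiffAt_linearMap (L : ℍ[ℝ] →ₗ[ℝ] ℝ) : ContDiffAt ℝ ∞ L q :=
    L.toContinuousLinearMap.contDiff.contDiffAt
  refine ((contDiffAt_const.sub (contDiffAt_linearMap (QuaternionAlgebra.reₗ _ _ _))).inv
    (sub_ne_zero.2 re_ne_one.symm)).smul (contDiffAt_euclidean.2 fun i => ?_)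
  fin_cases i
  exacts [contDiffAt_linearMap (QuaternionAlgebra.imIₗ _ _ _),
    contDiffAt_linearMap (QuaternionAlgebra.imJₗ _ _ _),
    contDiffAt_linearMap (QuaternionAlgebra.imKₗ _ _ _)]

theorem re_ne_one_of_norm_eq_one {q : ℍ[ℝ]} (norm_eq_one : ‖q‖ = 1) (ne_one : q ≠ 1) :
    q.re ≠ 1 := by
  contrapose! ne_one
  rw [← sub_eq_zero, ← norm_eq_zero, ← sq_eq_zero_iff, norm_sub_sq_real, norm_eq_one, norm_one,
    Quaternion.inner_def, star_one, mul_one, ne_one]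
  norm_num

theorem norm_sq_stereo {q : ℍ[ℝ]} (norm_eq_one : ‖q‖ = 1) (ne_one : q ≠ 1) :
    ‖stereo q‖ ^ 2 = 2 * (1 - q.re)⁻¹ - 1 := by
  have sum_sq : q.re ^ 2 + q.imI ^ 2 + q.imJ ^ 2 + q.imK ^ 2 = 1 := by
    rw [← Quaternion.normSq_def', Quaternion.normSq_eq_norm_mul_self, norm_eq_one, one_mul]
  have sub_re_ne_zero := sub_ne_zero.2 (re_ne_one_of_norm_eq_one norm_eq_one ne_one).symm
  have norm_sq_im : ‖!₂[q.imI, q.imJ, q.imK]‖ ^ 2 = (1 - q.re) * (1 + q.re) := by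
    simp only [EuclideanSpace.real_norm_sq_eq, Fin.sum_univ_three, Matrix.cons_val]
    linear_combination sum_sq
  rw [stereo, norm_smul, mul_pow, norm_sq_im, Real.norm_eq_abs, sq_abs]
  field_simp
  ring

theorem eq_of_stereo_eq {a b : ℍ[ℝ]} (ha : ‖a‖ = 1) (hb : ‖b‖ = 1) (ha1 : a ≠ 1) (hb1 : b ≠ 1)
    (stereo_eq : stereo a = stereo b) : a = b := by
  have inv_eq : (1 - a.re)⁻¹ = (1 - b.re)⁻¹ := by
    linear_combination (norm_sq_stereo hb hb1 - norm_sq_stereo ha ha1 +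
      congrArg (‖·‖ ^ 2) stereo_eq) / 2
  have inv_ne_zero : (1 - b.re)⁻¹ ≠ 0 :=
    inv_ne_zero (sub_ne_zero.2 (re_ne_one_of_norm_eq_one hb hb1).symm)
  rw [stereo, stereo, inv_eq] at stereo_eq
  have im_eq := smul_right_injective _ inv_ne_zero stereo_eq
  ext
  · linarith [inv_injective inv_eq]
  · exact congrArg (· 0) im_eq
  · exact congrArg (· 1) im_eq
  · exact congrArg (· 2) im_eq

theorem norm_inv_mul_S3 (x y : S3) : ‖(x : ℍ[ℝ])⁻¹ * y‖ = 1 := by simp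

theorem inv_mul_ne_one {x y : S3} (hxy : x ≠ y) : (x : ℍ[ℝ])⁻¹ * y ≠ 1 :=
  (inv_mul_eq_one₀ (coe_S3_ne_zero x)).not.2 (Subtype.coe_injective.ne hxy)

theorem confDiff_ne_zero {p : Fin 3 → S3} (hp : p.Injective) : confDiff (incl p) ≠ 0 := fun h =>
  hp.ne (by decide : (1 : Fin 3) ≠ 2) <| Subtype.ext <|
    mul_left_cancel₀ (inv_ne_zero (coe_S3_ne_zero (p 0))) <|
      eq_of_stereo_eq (norm_inv_mul_S3 _ _) (norm_inv_mul_S3 _ _)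
        (inv_mul_ne_one (hp.ne (by decide))) (inv_mul_ne_one (hp.ne (by decide))) (sub_eq_zero.1 h)

theorem contDiffAt_inv_mul {E 𝕜 R : Type*} [NontriviallyNormedField 𝕜] [NormedAddCommGroup E]
    [NormedSpace 𝕜 E] [NormedDivisionRing R] [NormedAlgebra 𝕜 R] [CompleteSpace R] {n : ℕ∞ω}
    {f g : E → R} {x : E} (hf : ContDiffAt 𝕜 n f x) (hg : ContDiffAt 𝕜 n g x) (ne_zero : f x ≠ 0) :
    ContDiffAt 𝕜 n (fun x => (f x)⁻¹ * g x) x := by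
  have contDiffAt_inv := contDiffAt_ringInverse 𝕜 (n := n) (Units.mk0 (f x) ne_zero)
  rw [Ring.inverse_eq_inv'] at contDiffAt_inv
  exact (contDiffAt_inv.comp x hf).mul hg

theorem contDiffAt_confMap {p : Fin 3 → S3} (hp : p.Injective) :
    ContDiffAt ℝ ∞ confMap (incl p) := by
  have contDiffAt_apply (i : Fin 3) : ContDiffAt ℝ ∞ (fun q : Amb => q i) (incl p) :=
    (contDiff_apply ℝ ℍ[ℝ] i).contDiffAt
  have contDiffAt_stereo_inv_mul (i : Fin 3) (hi : 0 ≠ i) :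
      ContDiffAt ℝ ∞ (fun q : Amb => stereo ((q 0)⁻¹ * q i)) (incl p) :=
    ContDiffAt.comp (g := stereo) (incl p)
      (contDiffAt_stereo (re_ne_one_of_norm_eq_one (norm_inv_mul_S3 (p 0) (p i))
        (inv_mul_ne_one (hp.ne hi))))
      (contDiffAt_inv_mul (contDiffAt_apply 0) (contDiffAt_apply i) (coe_S3_ne_zero (p 0)))
  exact contDiffAt_inv_norm_smul (f := confDiff) ((contDiffAt_stereo_inv_mul 1 (by decide)).sub
    (contDiffAt_stereo_inv_mul 2 (by decide))) (confDiff_ne_zero hp)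

theorem norm_confMap {p : Fin 3 → S3} (hp : p.Injective) : ‖confMap (incl p)‖ = 1 :=
  norm_smul_inv_norm (𝕜 := ℝ) (confDiff_ne_zero hp)

/-- The cone over `Conf₃(S³)`, an open neighbourhood of it in the ambient space: the triples of
nonzero quaternions with distinct directions. -/
def confCone : Set Amb := {q | (∀ i, q i ≠ 0) ∧ (fun i => retr (q i)).Injective}

theorem incl_mem_confCone {p : Fin 3 → S3} (hp : p.Injective) : incl p ∈ confCone :=
  ⟨fun i => coe_S3_ne_zero (p i), by simpa only [incl, retr_coe] using hp⟩

theorem isOpen_confCone : IsOpen confCone := by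
  rw [isOpen_iff_mem_nhds]
  rintro q ⟨ne_zero, injective⟩
  have continuousAt_retr (i : Fin 3) : ContinuousAt (fun q : Amb => retr (q i)) q :=
    ContinuousAt.comp (f := fun q : Amb => q i) (contMDiffAt_retr (ne_zero i)).continuousAt
      (continuous_apply i).continuousAt
  have eventually_ne_zero : ∀ᶠ q' : Amb in 𝓝 q, ∀ i, q' i ≠ 0 := eventually_all.2 fun i =>
    (continuous_apply i).continuousAt.eventually_ne (ne_zero i)
  have eventually_retr_ne :
      ∀ᶠ q' : Amb in 𝓝 q, ∀ i j, i ≠ j → retr (q' i) ≠ retr (q' j) :=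
    eventually_all.2 fun i => eventually_all.2 fun j => eventually_imp_distrib_left.2 fun hij =>
      ((continuousAt_retr i).ne_iff_eventually_ne (continuousAt_retr j)).1 (injective.ne hij)
  filter_upwards [eventually_ne_zero, eventually_retr_ne] with q' ne_zero' retr_ne
  exact ⟨ne_zero', fun i j => not_imp_not.1 (retr_ne i j)⟩

end ConfMap

section AmbientExtension

set_option maxSynthPendingDepth 3

/-- The map `g × g × g` of `S³ × S³ × S³`, extended to the ambient space by radial retraction. -/
def ambExt (g : S3 → S3) (q : Amb) : Amb := incl fun i => g (retr (q i))

theorem ambExt_incl (g : S3 → S3) (p : Fin 3 → S3) : ambExt g (incl p) = incl fun i => g (p i) := by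
  simp [ambExt, incl]

theorem ambExt_ambExt (f g : S3 → S3) (q : Amb) : ambExt f (ambExt g q) = ambExt (f ∘ g) q := by
  simp [ambExt, incl]

theorem incl_ne_zero (p : Fin 3 → S3) (i : Fin 3) : incl p i ≠ 0 := coe_S3_ne_zero (p i)

theorem fderiv_coe_retr {x : S3} {u : ℍ[ℝ]} (hu : inner ℝ (x : ℍ[ℝ]) u = 0) :
    fderiv ℝ (fun q => (retr q : ℍ[ℝ])) (x : ℍ[ℝ]) u = u := by
  obtain ⟨w, rfl⟩ := (range_mvfderiv_subtypeVal (n := 3) x).ge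
    (Submodule.mem_orthogonal_singleton_iff_inner_right.2 hu)
  exact (mfderiv_eq_fderiv_comp_retr (contMDiff_coe_S3 x) w).symm

theorem isTangent_slotVec (B : VField) (p : Fin 3 → S3) (i : Fin 3) :
    IsTangent p (slotVec B p i) := by
  intro j
  obtain rfl | hj := eq_or_ne j i
  · simpa [slotVec] using inner_coe_ambVec B (p j)
  · simp [slotVec, hj]

section

variable {g : S3 → S3} (hg : ContMDiff (𝓡 3) (𝓡 3) ∞ g)

include hg

theorem contDiffAt_coe_comp_retr {q : ℍ[ℝ]} (hq : q ≠ 0) :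
    ContDiffAt ℝ ∞ (fun q => (g (retr q) : ℍ[ℝ])) q :=
  contDiffAt_comp_retr (f := fun x => (g x : ℍ[ℝ])) hq ((contMDiff_coe_S3.comp hg) _)

theorem contDiffAt_ambExt {q : Amb} (hq : ∀ i, q i ≠ 0) : ContDiffAt ℝ ∞ (ambExt g) q :=
  contDiffAt_pi.2 fun i => ContDiffAt.comp (g := fun q : ℍ[ℝ] => (g (retr q) : ℍ[ℝ])) q
    (contDiffAt_coe_comp_retr hg (hq i)) (contDiff_apply ℝ ℍ[ℝ] i).contDiffAt

theorem fderiv_ambExt_apply (p : Fin 3 → S3) (u : Amb) (i : Fin 3) :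
    fderiv ℝ (ambExt g) (incl p) u i =
      fderiv ℝ (fun q => (g (retr q) : ℍ[ℝ])) (p i : ℍ[ℝ]) (u i) := by
  have differentiableAt_factor :
      DifferentiableAt ℝ (fun q => (g (retr q) : ℍ[ℝ])) (incl p i) :=
    (contDiffAt_coe_comp_retr hg (incl_ne_zero p i)).differentiableAt (by simp)
  have hasFDerivAt_factor := differentiableAt_factor.hasFDerivAt.comp (incl p)
    (hasFDerivAt_apply (𝕜 := ℝ) i (incl p))
  have hasFDerivAt_ambExt :=
    ((contDiffAt_ambExt hg (incl_ne_zero p)).differentiableAt (by simp)).hasFDerivAt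
  exact congrArg (fun L : Amb →L[ℝ] ℍ[ℝ] => L u)
    ((hasFDerivAt_pi'.1 hasFDerivAt_ambExt i).unique hasFDerivAt_factor)

theorem isTangent_fderiv_ambExt (p : Fin 3 → S3) (u : Amb) :
    IsTangent (fun i => g (p i)) (fderiv ℝ (ambExt g) (incl p) u) := by
  intro i
  rw [fderiv_ambExt_apply hg]
  simpa using inner_fderiv_eq_zero_of_norm_eq_one (F := fun q => (g (retr q) : ℍ[ℝ]))
    ((contDiffAt_coe_comp_retr hg (coe_S3_ne_zero (p i))).differentiableAt (by simp))
    (Eventually.of_forall fun z => by simp) (u i)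

end

theorem fderiv_ambExt_id {p : Fin 3 → S3} {u : Amb} (hu : IsTangent p u) :
    fderiv ℝ (ambExt id) (incl p) u = u := by
  ext1 i
  rw [fderiv_ambExt_apply contMDiff_id]
  exact fderiv_coe_retr (hu i)

end AmbientExtension

section Pullback

variable {X Y : Type*} [NormedAddCommGroup X] [NormedSpace ℝ X] [NormedAddCommGroup Y]
  [NormedSpace ℝ Y]

/-- The pull-back of the one-form `A` by `φ`. -/
def pullForm (φ : X → Y) (A : Y → Y →L[ℝ] ℝ) (x : X) : X →L[ℝ] ℝ :=
  (A (φ x)).comp (fderiv ℝ φ x)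

variable {φ : X → Y} {A : Y → Y →L[ℝ] ℝ} {x : X}

theorem contDiffAt_pullForm (hA : ContDiffAt ℝ ∞ A (φ x)) (hφ : ContDiffAt ℝ ∞ φ x) :
    ContDiffAt ℝ ∞ (pullForm φ A) x :=
  (hA.comp x hφ).clm_comp (hφ.fderiv_right (m := ∞) (by simp))

theorem extDerivOne_pullForm (hA : DifferentiableAt ℝ A (φ x)) (hφ : ContDiffAt ℝ 2 φ x) (u v : X) :
    extDerivOne (pullForm φ A) x u v =
      extDerivOne A (φ x) (fderiv ℝ φ x u) (fderiv ℝ φ x v) := by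
  have hasFDerivAt_comp := hA.hasFDerivAt.comp x (hφ.differentiableAt (by simp)).hasFDerivAt
  have hasFDerivAt_fderiv := ((hφ.fderiv_right (m := 1) (by norm_num)).differentiableAt
    (by simp)).hasFDerivAt
  have hasFDerivAt_pullForm : HasFDerivAt (pullForm φ A) _ x :=
    hasFDerivAt_comp.clm_comp hasFDerivAt_fderiv
  have symmetric : fderiv ℝ (fderiv ℝ φ) x u v = fderiv ℝ (fderiv ℝ φ) x v u :=
    (hφ.isSymmSndFDerivAt (by simp)).eq u v
  simp [extDerivOne, hasFDerivAt_pullForm.fderiv, symmetric]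

end Pullback

section Potentials

section

variable {E : Type*} [NormedAddCommGroup E] [NormedSpace ℝ E]

/-- Continuous alternating maps of degree one, the one-forms of `extDeriv`, as functions with
values in the dual space. -/
def oneForm (α : E → E [⋀^Fin 1]→L[ℝ] ℝ) (q : E) : E →L[ℝ] ℝ :=
  (ContinuousAlternatingMap.ofSubsingletonLIE (0 : Fin 1)).symm (α q)

/-- The inverse of `oneForm`. -/
def ofOneForm (A : E → E →L[ℝ] ℝ) (q : E) : E [⋀^Fin 1]→L[ℝ] ℝ :=
  ContinuousAlternatingMap.ofSubsingletonLIE (0 : Fin 1) (A q)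

theorem oneForm_ofOneForm (A : E → E →L[ℝ] ℝ) : oneForm (ofOneForm A) = A :=
  funext fun q => LinearIsometryEquiv.symm_apply_apply _ (A q)

variable {α : E → E [⋀^Fin 1]→L[ℝ] ℝ} {q : E}

theorem oneForm_apply (α : E → E [⋀^Fin 1]→L[ℝ] ℝ) (q u : E) : oneForm α q u = α q ![u] := by
  conv_rhs => rw [← LinearIsometryEquiv.apply_symm_apply
    (ContinuousAlternatingMap.ofSubsingletonLIE (𝕜 := ℝ) (0 : Fin 1)) (α q)]
  rfl

theorem contDiffAt_oneForm {n : ℕ∞ω} (hα : ContDiffAt ℝ n α q) : ContDiffAt ℝ n (oneForm α) q :=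
  (LinearIsometryEquiv.contDiff _).contDiffAt.comp q hα

theorem extDeriv_apply_eq_extDerivOne (hα : DifferentiableAt ℝ α q) (u v : E) :
    extDeriv α q ![u, v] = extDerivOne (oneForm α) q u v := by
  have differentiableAt_oneForm : DifferentiableAt ℝ (oneForm α) q :=
    LinearIsometryEquiv.differentiableAt _ |>.comp q hα
  have fderiv_oneForm (w z : E) :
      fderiv ℝ (oneForm α) q w z = fderiv ℝ (fun q => α q ![z]) q w := by
    simp only [← oneForm_apply]
    rw [fderiv_clm_apply differentiableAt_oneForm (differentiableAt_const z)]
    simp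
  have removeNth_zero : (0 : Fin 2).removeNth ![u, v] = ![v] := by
    ext1 i; fin_cases i; rfl
  have removeNth_one : (1 : Fin 2).removeNth ![u, v] = ![u] := by
    ext1 i; fin_cases i; rfl
  rw [extDeriv_apply hα, Fin.sum_univ_two, removeNth_zero, removeNth_one, extDerivOne,
    fderiv_oneForm, fderiv_oneForm]
  simp [sub_eq_add_neg]

end

set_option maxSynthPendingDepth 3

variable {T : Fin 3 → Set S3} {α : Amb → Amb [⋀^Fin 1]→L[ℝ] ℝ} {p : Fin 3 → S3}

theorem omega_apply (q u v : Amb) : omega q ![u, v] = pullArea confMap q u v := by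
  rw [pullArea, ← areaForm_apply, omega, AlternatingMap.compLinearMap_apply]
  congr 1
  ext1 i; fin_cases i <;> rfl

namespace IsPotential

theorem contDiffAt (hα : IsPotential T α) (hp : p ∈ prodDomain T) :
    ContDiffAt ℝ ∞ α (incl p) := by
  obtain ⟨U, isOpen, incl_subset, contDiffOn⟩ := hα.smooth
  exact contDiffOn.contDiffAt (isOpen.mem_nhds (incl_subset ⟨p, hp, rfl⟩))

theorem extDeriv_eq_extDerivOne (hα : IsPotential T α) (hp : p ∈ prodDomain T) (u v : Amb) :
    extDeriv α (incl p) ![u, v] = extDerivOne (oneForm α) (incl p) u v :=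
  extDeriv_apply_eq_extDerivOne ((hα.contDiffAt hp).differentiableAt (by simp)) u v

theorem smoothAlong_oneForm (hα : IsPotential T α) : SmoothAlong T (oneForm α) :=
  fun _ hp => contDiffAt_oneForm (hα.contDiffAt hp)

theorem extDerivOne_oneForm (hα : IsPotential T α) (hp : p ∈ prodDomain T) {u v : Amb}
    (hu : IsTangent p u) (hv : IsTangent p v) :
    extDerivOne (oneForm α) (incl p) u v = pullArea confMap (incl p) u v := by
  rw [← hα.extDeriv_eq_extDerivOne hp, hα.extDeriv_eq p hp u v hu hv, omega_apply]

theorem density_helicityForm_eq (hα : IsPotential T α) (B : VField) (hp : p ∈ prodDomain T) :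
    density (helicityForm B α) p = wedgeSlots B (oneForm α) (oneForm α) p := by
  simp only [density_helicityForm, wedgeSlots, wedgeOneTwo, oneForm_apply,
    hα.extDeriv_eq_extDerivOne hp]

theorem helicity_eq (hα : IsPotential T α) (B : VField) (hT : ∀ i, IsCompact (T i)) :
    helicity B T α = ∫ p in prodDomain T, wedgeSlots B (oneForm α) (oneForm α) p ∂vol3 :=
  setIntegral_congr_fun (measurableSet_prodDomain hT)
    fun _ hp => hα.density_helicityForm_eq B hp

variable {B : VField}

theorem integrableOn_density (hα : IsPotential T α) (hB : IsSVect B)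
    (hT : ∀ i, IsCompact (T i)) :
    IntegrableOn (density (helicityForm B α)) (prodDomain T) vol3 :=
  ((continuousOn_wedgeSlots hB hα.smoothAlong_oneForm hα.smoothAlong_oneForm).integrableOn_compact'
    (isCompact_prodDomain hT) (measurableSet_prodDomain hT)).congr_fun
    (fun _ hp => (hα.density_helicityForm_eq B hp).symm) (measurableSet_prodDomain hT)

theorem helicity_eq_helicity (hα : IsPotential T α) {α' : Amb → Amb [⋀^Fin 1]→L[ℝ] ℝ}
    (hα' : IsPotential T α') (hB : IsSVect B) (hT : ∀ i, IsCompact (T i))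
    (hBT : ∀ i, IsFlowInvariant B (T i)) : helicity B T α = helicity B T α' := by
  rw [hα.helicity_eq B hT, hα'.helicity_eq B hT]
  refine integral_wedgeSlots_eq_of_extDerivOne_eq hB hT hBT hα.smoothAlong_oneForm
    hα'.smoothAlong_oneForm fun p hp i j => ?_
  have tangent := isTangent_slotVec B p
  rw [hα.extDerivOne_oneForm hp (tangent i) (tangent j),
    hα'.extDerivOne_oneForm hp (tangent i) (tangent j)]

end IsPotential

theorem isPotential_ofOneForm {A : Amb → Amb →L[ℝ] ℝ} {U : Set Amb} (isOpen : IsOpen U)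
    (incl_mem : ∀ p ∈ prodDomain T, incl p ∈ U) (hA : ContDiffOn ℝ ∞ A U)
    (hdA : ∀ p ∈ prodDomain T, ∀ u v : Amb, IsTangent p u → IsTangent p v →
      extDerivOne A (incl p) u v = pullArea confMap (incl p) u v) :
    IsPotential T (ofOneForm A) := by
  have contDiffOn_ofOneForm : ContDiffOn ℝ ∞ (ofOneForm A) U :=
    (LinearIsometryEquiv.contDiff _).comp_contDiffOn hA
  refine ⟨⟨U, isOpen, Set.image_subset_iff.2 incl_mem, contDiffOn_ofOneForm⟩,
    fun p hp u v hu hv => ?_⟩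
  rw [extDeriv_apply_eq_extDerivOne ((contDiffOn_ofOneForm.contDiffAt
    (isOpen.mem_nhds (incl_mem p hp))).differentiableAt (by simp)), oneForm_ofOneForm,
    hdA p hp u v hu hv, omega_apply]

end Potentials

section PushForward

theorem isMIntegralCurve_comp {E H M E' H' M' : Type*} [NormedAddCommGroup E] [NormedSpace ℝ E]
    [TopologicalSpace H] {I : ModelWithCorners ℝ E H} [TopologicalSpace M] [ChartedSpace H M]
    [NormedAddCommGroup E'] [NormedSpace ℝ E'] [TopologicalSpace H'] {J : ModelWithCorners ℝ E' H'}
    [TopologicalSpace M'] [ChartedSpace H' M'] {f : M → M'} {γ : ℝ → M}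
    {X : (x : M) → TangentSpace I x} {Y : (y : M') → TangentSpace J y}
    (hγ : IsMIntegralCurve γ X) (hf : ∀ x, MDifferentiableAt I J f x)
    (related : ∀ x, mfderiv I J f x (X x) = Y (f x)) : IsMIntegralCurve (f ∘ γ) Y := by
  intro t
  have velocity_eq : (mfderiv I J f (γ t)).comp ((1 : ℝ →L[ℝ] ℝ).smulRight (X (γ t))) =
      (1 : ℝ →L[ℝ] ℝ).smulRight (Y (f (γ t))) := by
    rw [← related]
    ext
    simp
  exact ((hf (γ t)).hasMFDerivAt.comp t (hγ t)).congr_mfderiv velocity_eq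

theorem mdifferentiableAt_diffS3 (g : DiffS3) (x : S3) : MDifferentiableAt (𝓡 3) (𝓡 3) g x :=
  g.contMDiff.contMDiffAt.mdifferentiableAt (by simp)

theorem isInvertible_mfderiv_diffS3 (g : DiffS3) (x : S3) :
    (mfderiv (𝓡 3) (𝓡 3) g x).IsInvertible :=
  ⟨g.mfderivToContinuousLinearEquiv (by simp) x, rfl⟩

theorem mfderiv_symm_pushForward (g : DiffS3) (B : VField) (y : S3) :
    mfderiv (𝓡 3) (𝓡 3) g.symm y (pushForward g B y) = B (g.symm y) :=
  (isInvertible_mfderiv_diffS3 g.symm y).self_apply_inverse _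

theorem mfderiv_pushForward (g : DiffS3) (B : VField) (x : S3) :
    mfderiv (𝓡 3) (𝓡 3) g x (B x) = pushForward g B (g x) := by
  have symm_comp : HasMFDerivAt (𝓡 3) (𝓡 3) id x
      ((mfderiv (𝓡 3) (𝓡 3) g.symm (g x)).comp (mfderiv (𝓡 3) (𝓡 3) g x)) :=
    ((mdifferentiableAt_diffS3 g.symm (g x)).hasMFDerivAt.comp x
      (mdifferentiableAt_diffS3 g x).hasMFDerivAt).congr_of_eventuallyEq
        (Eventually.of_forall fun y => (g.symm_apply_apply y).symm)
  have symm_apply : mfderiv (𝓡 3) (𝓡 3) g.symm (g x) (mfderiv (𝓡 3) (𝓡 3) g x (B x)) = B x :=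
    DFunLike.congr_fun (hasMFDerivAt_unique symm_comp (hasMFDerivAt_id x)) (B x)
  have field_congr : ∀ z, z = x → (B z : EuclideanSpace ℝ (Fin 3)) = B x := by
    rintro z rfl
    rfl
  exact (isInvertible_mfderiv_diffS3 g.symm (g x)).injective <| symm_apply.trans <|
    (field_congr _ (g.symm_apply_apply x)).symm.trans (mfderiv_symm_pushForward g B (g x)).symm

theorem measurePreserving_symm {g : DiffS3} (hg : MeasurePreserving g vol vol) :
    MeasurePreserving g.symm vol vol :=
  MeasurePreserving.symm g.toHomeomorph.toMeasurableEquiv hg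

variable {B : VField} {T U : Set S3} {f : S3 → ℝ} {x : S3}

theorem IsSVect.pushForward (hB : IsSVect B) {g : DiffS3} (hg : MeasurePreserving g vol vol) :
    IsSVect (pushForward g B) := by
  obtain ⟨Φ, Φ_zero, hΦ, Φ_measurePreserving⟩ := hB.flow
  refine ⟨hB.smooth.mpullback_vectorField (n := ∞) g.symm.contMDiff
    (isInvertible_mfderiv_diffS3 g.symm) (by simp), fun t => g ∘ Φ t ∘ g.symm,
    fun y => by simp [Φ_zero], fun y => ?_,
    fun t => hg.comp ((Φ_measurePreserving t).comp (measurePreserving_symm hg))⟩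
  exact isMIntegralCurve_comp (hΦ (g.symm y)) (mdifferentiableAt_diffS3 g)
    (mfderiv_pushForward g B)

theorem IsFlowInvariant.pushForward (hT : IsFlowInvariant B T) (g : DiffS3) :
    IsFlowInvariant (pushForward g B) (g '' T) := by
  intro γ hγ mem_zero t
  rw [g.image_eq_preimage_symm] at mem_zero ⊢
  exact hT _ (isMIntegralCurve_comp hγ (mdifferentiableAt_diffS3 g.symm)
    (mfderiv_symm_pushForward g B)) mem_zero t

theorem IsBoundaryDefining.mfderiv_comp_diffS3 {g : DiffS3}
    (hf : IsBoundaryDefining T (g x) U f) (w : TangentSpace (𝓡 3) x) :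
    mfderiv (𝓡 3) 𝓘(ℝ, ℝ) (f ∘ g) x w =
      mfderiv (𝓡 3) 𝓘(ℝ, ℝ) f (g x) (mfderiv (𝓡 3) (𝓡 3) g x w) := by
  rw [mfderiv_comp x (hf.contMDiffAt.mdifferentiableAt (by simp)) (mdifferentiableAt_diffS3 g x)]
  rfl

theorem IsBoundaryDefining.comp_diffS3 {g : DiffS3} (hf : IsBoundaryDefining T (g x) U f) :
    IsBoundaryDefining (g ⁻¹' T) x (g ⁻¹' U) (f ∘ g) where
  isOpen := hf.isOpen.preimage g.continuous
  mem := hf.mem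
  smooth := hf.smooth.comp g.contMDiff.contMDiffOn fun _ hy => hy
  apply_eq_zero := hf.apply_eq_zero
  mfderiv_ne_zero := fun eq_zero => hf.mfderiv_ne_zero <| by
    ext w
    obtain ⟨v, rfl⟩ := (isInvertible_mfderiv_diffS3 g x).surjective w
    exact (hf.mfderiv_comp_diffS3 v).symm.trans (congrArg (· v) eq_zero)
  mem_iff := fun y hy => hf.mem_iff (g y) hy

theorem exists_eq_of_mem_frontier_image {g : DiffS3} {y : S3} (hy : y ∈ frontier (g '' T)) :
    ∃ x ∈ frontier T, g x = y := by
  rwa [← g.coe_toHomeomorph, ← g.toHomeomorph.image_frontier] at hy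

theorem IsTangentToBoundary.pushForward (hT : IsTangentToBoundary B T) (g : DiffS3) :
    IsTangentToBoundary (pushForward g B) (g '' T) := by
  intro y hy U f hf
  obtain ⟨x, hx, rfl⟩ := exists_eq_of_mem_frontier_image hy
  have preimage_image : g ⁻¹' (g '' T) = T := Set.preimage_image_eq T g.injective
  have hfg := hf.comp_diffS3
  rw [preimage_image] at hfg
  rw [← mfderiv_pushForward, ← hf.mfderiv_comp_diffS3]
  exact hT x hx _ _ hfg

theorem IsHandlebody.image (hT : IsHandlebody T) (g : DiffS3) : IsHandlebody (g '' T) where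
  model := by
    obtain ⟨n, ⟨homeomorph⟩⟩ := hT.model
    exact ⟨n, ⟨(g.toHomeomorph.image T).symm.trans homeomorph⟩⟩
  smooth_boundary := by
    intro y hy
    obtain ⟨x, hx, rfl⟩ := exists_eq_of_mem_frontier_image hy
    obtain ⟨U, f, hf⟩ := hT.smooth_boundary x hx
    rw [g.image_eq_preimage_symm]
    exact ⟨_, _, IsBoundaryDefining.comp_diffS3 (by rwa [g.symm_apply_apply])⟩

theorem isCompact_handlebodyModel (n : ℕ) : IsCompact (handlebodyModel n) :=
  ((isCompact_closedBall _ _).diff (isOpen_biUnion fun _ _ => Metric.isOpen_ball)).prod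
    isCompact_Icc

theorem IsHandlebody.isCompact (hT : IsHandlebody T) : IsCompact T := by
  obtain ⟨n, ⟨homeomorph⟩⟩ := hT.model
  have := isCompact_iff_compactSpace.1 (isCompact_handlebodyModel n)
  exact isCompact_iff_compactSpace.2 homeomorph.symm.compactSpace

theorem ambVec_pushForward (g : DiffS3) (B : VField) (x : S3) :
    ambVec (pushForward g B) (g x) =
      fderiv ℝ (fun q => (g (retr q) : ℍ[ℝ])) (x : ℍ[ℝ]) (ambVec B x) := by
  have chain_rule := mfderiv_comp x ((contMDiff_coe_S3 (g x)).mdifferentiableAt (by simp))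
    (mdifferentiableAt_diffS3 g x)
  rw [ambVec, ← mfderiv_pushForward]
  exact (DFunLike.congr_fun chain_rule (B x)).symm.trans
    (mfderiv_eq_fderiv_comp_retr (contMDiff_coe_S3.comp g.contMDiff x) (B x))

theorem slotVec_pushForward (g : DiffS3) (B : VField) (p : Fin 3 → S3) (i : Fin 3) :
    slotVec (pushForward g B) (fun j => g (p j)) i =
      fderiv ℝ (ambExt g) (incl p) (slotVec B p i) := by
  ext1 j
  rw [fderiv_ambExt_apply g.contMDiff]
  obtain rfl | hj := eq_or_ne j i
  · simp [slotVec, ambVec_pushForward]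
  · simp [slotVec, hj]

end PushForward

section Isotopy

set_option maxSynthPendingDepth 3

/-- The diffeomorphisms `G t` depend smoothly on the time `t ∈ [0, 1]`. -/
def IsSmoothIsotopy (G : ℝ → DiffS3) : Prop :=
  ContMDiffOn (𝓘(ℝ, ℝ).prod (𝓡 3)) (𝓡 3) ∞ (fun q : ℝ × S3 => G q.1 q.2)
    (Set.Icc (0 : ℝ) 1 ×ˢ Set.univ)

/-- The homotopy of maps to `S²` induced by the isotopy `G`: at time `t` it is `H ∘ G s`, extended
by radial retraction, where `s = Real.smoothTransition t` makes it smooth for all `t ∈ ℝ`. -/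
def isoMap (G : ℝ → DiffS3) (y : ℝ × Amb) : EuclideanSpace ℝ (Fin 3) :=
  confMap (ambExt (G (Real.smoothTransition y.1)) y.2)

variable {G : ℝ → DiffS3}

theorem IsSmoothIsotopy.contDiffAt_coe_comp_retr (hG : IsSmoothIsotopy G) (t : ℝ) {q : ℍ[ℝ]}
    (hq : q ≠ 0) :
    ContDiffAt ℝ ∞ (fun y : ℝ × ℍ[ℝ] => (G (Real.smoothTransition y.1) (retr y.2) : ℍ[ℝ]))
      (t, q) := by
  let φ : ℝ × ℍ[ℝ] → ℝ × S3 := fun y => (Real.smoothTransition y.1, retr y.2)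
  have mapsTo : Set.MapsTo φ Set.univ (Set.Icc (0 : ℝ) 1 ×ˢ Set.univ) := fun y _ =>
    ⟨⟨Real.smoothTransition.nonneg y.1, Real.smoothTransition.le_one y.1⟩, trivial⟩
  have contMDiffAt_φ : ContMDiffAt 𝓘(ℝ, ℝ × ℍ[ℝ]) (𝓘(ℝ, ℝ).prod (𝓡 3)) ∞ φ (t, q) :=
    ((Real.smoothTransition.contDiff (n := ⊤)).comp contDiff_fst).contMDiff.contMDiffAt.prodMk
      ((contMDiffAt_retr hq).comp (t, q) contDiff_snd.contMDiff.contMDiffAt)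
  have contMDiffAt_comp := ((hG (φ (t, q)) (mapsTo trivial)).comp (t, q)
    contMDiffAt_φ.contMDiffWithinAt mapsTo).contMDiffAt univ_mem
  exact ((contMDiff_coe_S3 _).comp (t, q) contMDiffAt_comp).contDiffAt

theorem IsSmoothIsotopy.isSphereHomotopy_isoMap (hG : IsSmoothIsotopy G) :
    IsSphereHomotopy (isoMap G) confCone where
  isOpen := isOpen_confCone
  contDiffOn := by
    rintro ⟨t, q⟩ ⟨-, ne_zero, injective⟩
    have contDiffAt_ambExt_isotopy : ContDiffAt ℝ ∞
        (fun y : ℝ × Amb => ambExt (G (Real.smoothTransition y.1)) y.2) (t, q) :=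
      contDiffAt_pi.2 fun i => ContDiffAt.comp (f := fun y : ℝ × Amb => (y.1, y.2 i)) (t, q)
        (hG.contDiffAt_coe_comp_retr t (ne_zero i))
        (contDiffAt_fst.prodMk ((contDiff_apply ℝ ℍ[ℝ] i).contDiffAt.comp (t, q) contDiffAt_snd))
    exact (ContDiffAt.comp (g := confMap) (t, q)
      (contDiffAt_confMap ((G _).injective.comp injective))
      contDiffAt_ambExt_isotopy).contDiffWithinAt
  norm_eq_one := fun _ hy => norm_confMap ((G _).injective.comp hy.2.2)

theorem IsSDiff0.exists_isSphereHomotopy {g : DiffS3} (hg : IsSDiff0 g) :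
    ∃ F : ℝ × Amb → EuclideanSpace ℝ (Fin 3), IsSphereHomotopy F confCone ∧
      (∀ q, F (0, q) = confMap (ambExt id q)) ∧ ∀ q, F (1, q) = confMap (ambExt g q) := by
  obtain ⟨G, hG, G_zero, G_one⟩ := hg.isotopic
  have coe_G_zero : ⇑(G 0) = id := funext G_zero
  have coe_G_one : ⇑(G 1) = g := funext G_one
  refine ⟨isoMap G, IsSmoothIsotopy.isSphereHomotopy_isoMap hG, fun q => ?_, fun q => ?_⟩
  · rw [isoMap, Real.smoothTransition.zero, coe_G_zero]
  · rw [isoMap, Real.smoothTransition.one, coe_G_one]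

theorem pullArea_confMap_ambExt {f : S3 → S3} (hf : ContMDiff (𝓡 3) (𝓡 3) ∞ f)
    {p : Fin 3 → S3} (hfp : (fun i => f (p i)).Injective) (u v : Amb) :
    pullArea (fun q => confMap (ambExt f q)) (incl p) u v =
      pullArea confMap (incl fun i => f (p i)) (fderiv ℝ (ambExt f) (incl p) u)
        (fderiv ℝ (ambExt f) (incl p) v) := by
  have differentiableAt_confMap : DifferentiableAt ℝ confMap (ambExt f (incl p)) := by
    rw [ambExt_incl]
    exact (contDiffAt_confMap hfp).differentiableAt (by simp)
  rw [pullArea_comp differentiableAt_confMap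
    ((contDiffAt_ambExt hf (incl_ne_zero p)).differentiableAt (by simp)), ambExt_incl]

theorem pullArea_confMap_ambExt_id {p : Fin 3 → S3} (hp : p.Injective) {u v : Amb}
    (hu : IsTangent p u) (hv : IsTangent p v) :
    pullArea (fun q => confMap (ambExt id q)) (incl p) u v = pullArea confMap (incl p) u v := by
  rw [pullArea_confMap_ambExt contMDiff_id hp, fderiv_ambExt_id hu, fderiv_ambExt_id hv]
  rfl

end Isotopy

section Transport

variable {T : Fin 3 → Set S3} {p : Fin 3 → S3}

theorem fderiv_ambExt_symm (g : DiffS3) {u : Amb} (hu : IsTangent (fun i => g (p i)) u) :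
    fderiv ℝ (ambExt g) (incl p) (fderiv ℝ (ambExt g.symm) (incl fun i => g (p i)) u) = u := by
  have ambExt_comp : ambExt g ∘ ambExt g.symm = ambExt id := by
    ext1 q
    simp [ambExt_ambExt, Function.comp_def, Function.id_def]
  have ambExt_symm : ambExt g.symm (incl fun i => g (p i)) = incl p := by simp [ambExt_incl]
  have differentiableAt (h : DiffS3) (p : Fin 3 → S3) : DifferentiableAt ℝ (ambExt h) (incl p) :=
    (contDiffAt_ambExt h.contMDiff (incl_ne_zero p)).differentiableAt (by simp)
  have chain_rule := fderiv_comp (incl fun i => g (p i))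
    (by rw [ambExt_symm]; exact differentiableAt g p) (differentiableAt g.symm _)
  rw [ambExt_comp, ambExt_symm] at chain_rule
  exact (congrArg (· u) chain_rule).symm.trans (fderiv_ambExt_id hu)

theorem isOpen_ambExt_preimage {f : S3 → S3} (hf : ContMDiff (𝓡 3) (𝓡 3) ∞ f) {U : Set Amb}
    (hU : IsOpen U) : IsOpen {q : Amb | (∀ i, q i ≠ 0) ∧ ambExt f q ∈ U} := by
  rw [isOpen_iff_mem_nhds]
  rintro q ⟨ne_zero, hq⟩
  have eventually_ne_zero : ∀ᶠ q' in 𝓝 q, ∀ i, q' i ≠ 0 := eventually_all.2 fun i =>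
    (continuous_apply i).continuousAt.eventually_ne (ne_zero i)
  exact eventually_ne_zero.and
    ((contDiffAt_ambExt hf ne_zero).continuousAt.eventually (hU.mem_nhds hq))

theorem prodDomain_image (g : DiffS3) (T : Fin 3 → Set S3) :
    prodDomain (fun i => g '' T i) = (fun p i => g (p i)) '' prodDomain T :=
  (Set.piMap_image_univ_pi (fun _ => g) T).symm

theorem mem_prodDomain_image (g : DiffS3) (hp : p ∈ prodDomain T) :
    (fun i => g (p i)) ∈ prodDomain fun i => g '' T i :=
  (prodDomain_image g T).ge ⟨p, hp, rfl⟩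

theorem setIntegral_prodDomain_image {g : DiffS3} (hg : MeasurePreserving g vol vol)
    (f : (Fin 3 → S3) → ℝ) :
    ∫ p in prodDomain (fun i => g '' T i), f p ∂vol3 =
      ∫ p in prodDomain T, f (fun i => g (p i)) ∂vol3 := by
  have measurePreserving : MeasurePreserving (fun (p : Fin 3 → S3) i => g (p i)) vol3 vol3 :=
    measurePreserving_pi _ _ fun _ => hg
  rw [prodDomain_image]
  exact measurePreserving.setIntegral_image_emb
    (Homeomorph.piCongrRight fun _ : Fin 3 => g.toHomeomorph).measurableEmbedding f _

theorem injective_of_mem_prodDomain (disjoint : ∀ i j, i ≠ j → Disjoint (T i) (T j))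
    (hp : p ∈ prodDomain T) : p.Injective := by
  intro i j eq
  by_contra ne
  exact (disjoint i j ne).le_bot ⟨hp i trivial, eq ▸ hp j trivial⟩

theorem SmoothAlong.pullForm_ambExt {g : DiffS3} {A : Amb → Amb →L[ℝ] ℝ}
    (hA : SmoothAlong (fun i => g '' T i) A) : SmoothAlong T (pullForm (ambExt g) A) :=
  fun p hp => contDiffAt_pullForm
    (by rw [ambExt_incl]; exact hA _ (mem_prodDomain_image g hp))
    (contDiffAt_ambExt g.contMDiff (incl_ne_zero p))

theorem extDerivOne_pullForm_ambExt {f : S3 → S3} (hf : ContMDiff (𝓡 3) (𝓡 3) ∞ f)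
    {A : Amb → Amb →L[ℝ] ℝ} (hA : ContDiffAt ℝ ∞ A (incl fun i => f (p i))) (u v : Amb) :
    extDerivOne (pullForm (ambExt f) A) (incl p) u v = extDerivOne A (incl fun i => f (p i))
      (fderiv ℝ (ambExt f) (incl p) u) (fderiv ℝ (ambExt f) (incl p) v) := by
  rw [← ambExt_incl] at hA ⊢
  exact extDerivOne_pullForm (hA.differentiableAt (by simp))
    ((contDiffAt_ambExt hf (incl_ne_zero p)).of_le ENat.LEInfty.out) u v

theorem wedgeSlots_pushForward (B : VField) (g : DiffS3) {A : Amb → Amb →L[ℝ] ℝ}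
    (hA : ContDiffAt ℝ ∞ A (incl fun i => g (p i))) :
    wedgeSlots (pushForward g B) A A (fun i => g (p i)) =
      wedgeSlots B (pullForm (ambExt g) A) (pullForm (ambExt g) A) p := by
  simp only [wedgeSlots, wedgeOneTwo, extDerivOne_pullForm_ambExt g.contMDiff hA,
    slotVec_pushForward, pullForm, ambExt_incl, ContinuousLinearMap.comp_apply]

theorem integral_wedgeSlots_pushForward (B : VField) {g : DiffS3}
    (hg : MeasurePreserving g vol vol) (hT : ∀ i, IsCompact (T i)) {A : Amb → Amb →L[ℝ] ℝ}
    (hA : SmoothAlong (fun i => g '' T i) A) :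
    ∫ p in prodDomain fun i => g '' T i, wedgeSlots (pushForward g B) A A p ∂vol3 =
      ∫ p in prodDomain T,
        wedgeSlots B (pullForm (ambExt g) A) (pullForm (ambExt g) A) p ∂vol3 := by
  rw [setIntegral_prodDomain_image hg]
  exact setIntegral_congr_fun (measurableSet_prodDomain hT) fun _ hp =>
    wedgeSlots_pushForward B g (hA _ (mem_prodDomain_image g hp))

end Transport

section Invariance

set_option maxSynthPendingDepth 3

/-- The sets `T i` form an unlinked triple that is invariant under `B`, where arbitrary compact
sets take the place of handlebodies and invariance under the flow that of tangency. -/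
structure IsInvariantUnlinkedCompact (B : VField) (T : Fin 3 → Set S3) : Prop where
  disjoint : ∀ i j, i ≠ j → Disjoint (T i) (T j)
  isCompact : ∀ i, IsCompact (T i)
  exact : ∃ α, IsPotential T α
  isFlowInvariant : ∀ i, IsFlowInvariant B (T i)

variable {B : VField} {T : Fin 3 → Set S3} {g : DiffS3} {α α' : Amb → Amb [⋀^Fin 1]→L[ℝ] ℝ}

theorem IsInvariantUnlinkedHandlebody.isInvariantUnlinkedCompact
    (hT : IsInvariantUnlinkedHandlebody B T) (hB : IsSVect B) : IsInvariantUnlinkedCompact B T where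
  disjoint := hT.disjoint
  isCompact i := (hT.handlebody i).isCompact
  exact := hT.exact
  isFlowInvariant i := (hT.tangent i).isFlowInvariant hB (hT.handlebody i).isCompact.isClosed
    (hT.handlebody i).smooth_boundary

theorem IsPotential.exists_primitive_confMap_ambExt (hα : IsPotential T α)
    (disjoint : ∀ i j, i ≠ j → Disjoint (T i) (T j)) (hg : IsSDiff0 g) :
    ∃ A : Amb → Amb →L[ℝ] ℝ,
      (∃ U, IsOpen U ∧ (∀ p ∈ prodDomain T, incl p ∈ U) ∧ ContDiffOn ℝ ∞ A U) ∧
      (∀ p ∈ prodDomain T, ∀ u v : Amb, IsTangent p u → IsTangent p v →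
        extDerivOne A (incl p) u v = pullArea (fun q => confMap (ambExt g q)) (incl p) u v) ∧
      ∀ B, IsSVect B → (∀ i, IsCompact (T i)) → (∀ i, IsFlowInvariant B (T i)) →
        ∫ p in prodDomain T, wedgeSlots B A A p ∂vol3 =
          ∫ p in prodDomain T, wedgeSlots B (oneForm α) (oneForm α) p ∂vol3 := by
  obtain ⟨F, hF, F_zero, F_one⟩ := hg.exists_isSphereHomotopy
  obtain ⟨U, isOpen, image_subset, contDiffOn⟩ := hα.smooth
  have injective {p : Fin 3 → S3} (hp : p ∈ prodDomain T) := injective_of_mem_prodDomain disjoint hp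
  have incl_mem : ∀ p ∈ prodDomain T, incl p ∈ confCone :=
    fun p hp => incl_mem_confCone (injective hp)
  have primitive_zero {p : Fin 3 → S3} (hp : p ∈ prodDomain T) {u v : Amb} (hu : IsTangent p u)
      (hv : IsTangent p v) :
      extDerivOne (oneForm α) (incl p) u v = pullArea (fun q => F (0, q)) (incl p) u v := by
    rw [funext F_zero, pullArea_confMap_ambExt_id (injective hp) hu hv]
    exact hα.extDerivOne_oneForm hp hu hv
  refine ⟨evolvedForm (oneForm α) F 1, ⟨U ∩ confCone, isOpen.inter isOpen_confCone,
    fun p hp => ⟨image_subset ⟨p, hp, rfl⟩, incl_mem p hp⟩, fun q hq => ?_⟩,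
    fun p hp u v hu hv => ?_, fun B hB hT hBT => ?_⟩
  · exact ((contDiffAt_oneForm (contDiffOn.contDiffAt (isOpen.mem_nhds hq.1))).add
      (hF.contDiffAt_kappaForm 1 hq.2)).contDiffWithinAt
  · rw [← funext F_one]
    exact hF.extDerivOne_evolvedForm (incl_mem p hp)
      ((hα.smoothAlong_oneForm p hp).differentiableAt (by simp)) (primitive_zero hp hu hv) 1
  · exact hF.integral_wedgeSlots_evolvedForm incl_mem hB hT hBT hα.smoothAlong_oneForm
      (fun p hp i j => primitive_zero hp (isTangent_slotVec B p i) (isTangent_slotVec B p j)) 1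

theorem isPotential_image_ofOneForm {A : Amb → Amb →L[ℝ] ℝ} {U : Set Amb}
    (disjoint : ∀ i j, i ≠ j → Disjoint (T i) (T j)) (isOpen : IsOpen U)
    (incl_mem : ∀ p ∈ prodDomain T, incl p ∈ U) (hA : ContDiffOn ℝ ∞ A U)
    (hdA : ∀ p ∈ prodDomain T, ∀ u v : Amb, IsTangent p u → IsTangent p v →
      extDerivOne A (incl p) u v = pullArea (fun q => confMap (ambExt g q)) (incl p) u v) :
    IsPotential (fun i => g '' T i) (ofOneForm (pullForm (ambExt g.symm) A)) := by
  have contDiffAt_A {q : Amb} (hq : q ∈ U) := hA.contDiffAt (isOpen.mem_nhds hq)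
  have symm_apply (p : Fin 3 → S3) : (fun i => g.symm (g (p i))) = p := by simp
  refine isPotential_ofOneForm (isOpen_ambExt_preimage g.symm.contMDiff isOpen)
    (fun p hp => ⟨incl_ne_zero p, ?_⟩) (fun q hq => (contDiffAt_pullForm (contDiffAt_A hq.2)
      (contDiffAt_ambExt g.symm.contMDiff hq.1)).contDiffWithinAt) fun p hp u v hu hv => ?_
  all_goals obtain ⟨p, hpT, rfl⟩ := (prodDomain_image g T).le hp
  · rw [ambExt_incl, symm_apply]
    exact incl_mem p hpT
  · have tangent (w : Amb) : IsTangent p (fderiv ℝ (ambExt g.symm) (incl fun i => g (p i)) w) := by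
      simpa only [symm_apply] using
        isTangent_fderiv_ambExt g.symm.contMDiff (fun i => g (p i)) w
    rw [extDerivOne_pullForm_ambExt g.symm.contMDiff
        (by rw [symm_apply]; exact contDiffAt_A (incl_mem p hpT)), symm_apply,
      hdA p hpT _ _ (tangent u) (tangent v), pullArea_confMap_ambExt g.contMDiff
        (g.injective.comp (injective_of_mem_prodDomain disjoint hpT)),
      fderiv_ambExt_symm g hu, fderiv_ambExt_symm g hv]

theorem IsPotential.exists_isPotential_image (hα : IsPotential T α)
    (disjoint : ∀ i j, i ≠ j → Disjoint (T i) (T j)) (hg : IsSDiff0 g) :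
    ∃ α', IsPotential (fun i => g '' T i) α' := by
  obtain ⟨A, ⟨U, isOpen, incl_mem, hA⟩, hdA, -⟩ := hα.exists_primitive_confMap_ambExt disjoint hg
  exact ⟨_, isPotential_image_ofOneForm disjoint isOpen incl_mem hA hdA⟩

theorem disjoint_image_diffS3 (disjoint : ∀ i j, i ≠ j → Disjoint (T i) (T j)) (g : DiffS3)
    (i j : Fin 3) (hij : i ≠ j) : Disjoint (g '' T i) (g '' T j) :=
  (Set.disjoint_image_iff g.injective).2 (disjoint i j hij)

theorem IsInvariantUnlinkedHandlebody.image (hT : IsInvariantUnlinkedHandlebody B T)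
    (hg : IsSDiff0 g) : IsInvariantUnlinkedHandlebody (pushForward g B) (fun i => g '' T i) where
  disjoint := disjoint_image_diffS3 hT.disjoint g
  handlebody i := (hT.handlebody i).image g
  exact := hT.exact.elim fun _ hα => hα.exists_isPotential_image hT.disjoint hg
  tangent i := (hT.tangent i).pushForward g

theorem IsInvariantUnlinkedCompact.image (hT : IsInvariantUnlinkedCompact B T)
    (hg : IsSDiff0 g) : IsInvariantUnlinkedCompact (pushForward g B) (fun i => g '' T i) where
  disjoint := disjoint_image_diffS3 hT.disjoint g
  isCompact i := (hT.isCompact i).image g.continuous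
  exact := hT.exact.elim fun _ hα => hα.exists_isPotential_image hT.disjoint hg
  isFlowInvariant i := (hT.isFlowInvariant i).pushForward g

theorem IsPotential.extDerivOne_pullForm_oneForm (hα' : IsPotential (fun i => g '' T i) α')
    (disjoint : ∀ i j, i ≠ j → Disjoint (T i) (T j)) {p : Fin 3 → S3} (hp : p ∈ prodDomain T)
    (u v : Amb) :
    extDerivOne (pullForm (ambExt g) (oneForm α')) (incl p) u v =
      pullArea (fun q => confMap (ambExt g q)) (incl p) u v := by
  have hgp := mem_prodDomain_image g hp
  have tangent := isTangent_fderiv_ambExt g.contMDiff p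
  rw [extDerivOne_pullForm_ambExt g.contMDiff (hα'.smoothAlong_oneForm _ hgp),
    hα'.extDerivOne_oneForm hgp (tangent u) (tangent v), pullArea_confMap_ambExt g.contMDiff
      (g.injective.comp (injective_of_mem_prodDomain disjoint hp))]

theorem IsInvariantUnlinkedCompact.helicity_pushForward (hT : IsInvariantUnlinkedCompact B T)
    (hB : IsSVect B) (hg : IsSDiff0 g) (hα : IsPotential T α)
    (hα' : IsPotential (fun i => g '' T i) α') :
    helicity B T α = helicity (pushForward g B) (fun i => g '' T i) α' := by
  obtain ⟨A, ⟨U, isOpen, incl_mem, hA⟩, hdA, integral_eq⟩ :=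
    hα.exists_primitive_confMap_ambExt hT.disjoint hg
  have smoothAlong_A : SmoothAlong T A := fun p hp =>
    hA.contDiffAt (isOpen.mem_nhds (incl_mem p hp))
  have smoothAlong_oneForm := hα'.smoothAlong_oneForm
  calc helicity B T α
      = ∫ p in prodDomain T, wedgeSlots B (oneForm α) (oneForm α) p ∂vol3 :=
        hα.helicity_eq B hT.isCompact
    _ = ∫ p in prodDomain T, wedgeSlots B A A p ∂vol3 :=
        (integral_eq B hB hT.isCompact hT.isFlowInvariant).symm
    _ = ∫ p in prodDomain T, wedgeSlots B (pullForm (ambExt g) (oneForm α'))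
          (pullForm (ambExt g) (oneForm α')) p ∂vol3 :=
        integral_wedgeSlots_eq_of_extDerivOne_eq hB hT.isCompact hT.isFlowInvariant smoothAlong_A
          smoothAlong_oneForm.pullForm_ambExt fun p hp i j =>
            (hdA p hp _ _ (isTangent_slotVec B p i) (isTangent_slotVec B p j)).trans
              (hα'.extDerivOne_pullForm_oneForm hT.disjoint hp _ _).symm
    _ = ∫ p in prodDomain fun i => g '' T i,
          wedgeSlots (pushForward g B) (oneForm α') (oneForm α') p ∂vol3 :=
        (integral_wedgeSlots_pushForward B hg.measurePreserving hT.isCompact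
          smoothAlong_oneForm).symm
    _ = helicity (pushForward g B) (fun i => g '' T i) α' :=
        (hα'.helicity_eq _ (hT.image hg).isCompact).symm

end Invariance

end Helicity

end

theorem mainTheorem2_general (B : Helicity.VField) (hB : Helicity.IsSVect B)
    (T : Fin 3 → Set Helicity.S3) (hT : Helicity.IsInvariantUnlinkedCompact B T) :
    (∀ α, Helicity.IsPotential T α →
      IntegrableOn (Helicity.density (Helicity.helicityForm B α)) (Helicity.prodDomain T)
        Helicity.vol3) ∧
    (∀ α α', Helicity.IsPotential T α → Helicity.IsPotential T α' →
      Helicity.helicity B T α = Helicity.helicity B T α') ∧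
    (∀ g : Helicity.DiffS3, Helicity.IsSDiff0 g →
      Helicity.IsSVect (Helicity.pushForward g B) ∧
      Helicity.IsInvariantUnlinkedCompact (Helicity.pushForward g B) (fun i => g '' T i) ∧
      ∀ α α', Helicity.IsPotential T α → Helicity.IsPotential (fun i => g '' T i) α' →
        Helicity.helicity B T α =
          Helicity.helicity (Helicity.pushForward g B) (fun i => g '' T i) α') :=
  ⟨fun _ hα => hα.integrableOn_density hB hT.isCompact,
    fun _ _ hα hα' => hα.helicity_eq_helicity hα' hB hT.isCompact hT.isFlowInvariant,
    fun _ hg => ⟨hB.pushForward hg.measurePreserving, hT.image hg,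
      fun _ _ hα hα' => hT.helicity_pushForward hB hg hα hα'⟩⟩

theorem mainTheorem2 (B : Helicity.VField) (hB : Helicity.IsSVect B)
    (T : Fin 3 → Set Helicity.S3) (hT : Helicity.IsInvariantUnlinkedHandlebody B T) :
    (∀ α, Helicity.IsPotential T α →
      IntegrableOn (Helicity.density (Helicity.helicityForm B α)) (Helicity.prodDomain T)
        Helicity.vol3) ∧
    (∀ α α', Helicity.IsPotential T α → Helicity.IsPotential T α' →
      Helicity.helicity B T α = Helicity.helicity B T α') ∧
    (∀ g : Helicity.DiffS3, Helicity.IsSDiff0 g →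
      Helicity.IsSVect (Helicity.pushForward g B) ∧
      Helicity.IsInvariantUnlinkedHandlebody (Helicity.pushForward g B) (fun i => g '' T i) ∧
      ∀ α α', Helicity.IsPotential T α → Helicity.IsPotential (fun i => g '' T i) α' →
        Helicity.helicity B T α =
          Helicity.helicity (Helicity.pushForward g B) (fun i => g '' T i) α') :=
  have ⟨integrable, independent, invariant⟩ :=
    mainTheorem2_general B hB T (hT.isInvariantUnlinkedCompact hB)
  ⟨integrable, independent, fun g hg => ⟨(invariant g hg).1, hT.image hg, (invariant g hg).2.2⟩⟩
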